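/- **Setting.** Let $\mathcal D$ be a set (e.g. $\mathcal D\subset\mathbb R^d$), let $C_0$ be a symmetric positive semidefinite covariance function on $\mathcal D$, and let $M\ge 0$. Let $\mathcal D$ be recursively partitioned: for $m=1,\dots,M$, each region $\mathcal D_{j_1,\dots,j_{m-1}}$ (for $m=1$ this is $\mathcal D$) is the disjoint union of $\mathcal D_{j_1,\dots,j_m}$, $j_m=1,\dots,J$. For $m<M$ let $\mathcal Q_{j_1,\dots,j_m}\subset\mathcal D_{j_1,\dots,j_m}$ be a finite set of knots (the number of knots may depend on the region). Set $v_0=C_0$ and, for $m=0,\dots,M-1$, $\mathbf b_{j_1,\dots,j_m}(s)=v_m(s,\mathcal Q_{j_1,\dots,j_m})$ for $s\in\mathcal D_{j_1,\dots,j_m}$, $\mathbf K_{j_1,\dots,j_m}^{-1}=v_m(\mathcal Q_{j_1,\dots,j_m},\mathcal Q_{j_1,\dots,j_m})$, and $$v_{m+1}(s,t)=v_m(s,t)-\mathbf b_{j_1,\dots,j_m}(s)'\,\mathbf K_{j_1,\dots,j_m}\,\mathbf b_{j_1,\dots,j_m}(t)$$ if $s,t$ lie in a common region at level $m+1$ (contained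 in $\mathcal D_{j_1,\dots,j_m}$), and $v_{m+1}(s,t)=0$ otherwise. The multi-resolution approximation is $$y_M(s)=\sum_{m=0}^{M-1}\mathbf b_{j_1,\dots,j_m}(s)'\boldsymbol\eta_{j_1,\dots,j_m}+\delta_M(s),\qquad s\in\mathcal D_{j_1,\dots,j_M},$$ where the weight vectors $\boldsymbol\eta_{j_1,\dots,j_m}\sim N(\mathbf 0,\mathbf K_{j_1,\dots,j_m})$ are independent of each other and of the zero-mean Gaussian process $\delta_M\sim GP(0,v_M)$. Let $\mathcal E_m$ be the set of all weight vectors at levels $0,\dots,m$ ($\mathcal E_{-1}=\emptyset$). Let $\mathcal S$ and $\mathcal S^P$ be finite sets of observation and prediction locations, and let $\mathcal S_{j_1,\dots,j_m}$, $\mathcal S^P_{j_1,\dots,j_m}$ be their parts in $\mathcal D_{j_1,\dots,j_m}$. Assume that the matrices $v_m(\mathcal Q_{j_1,\dots,j_m},\mathcal Q_{j_1,\dots,j_m})$, $m<M$, and $v_M(\mathcal S_{j_1,\dots,j_M},\mathcal S_{j_1,\dots,j_M})$ are nonsingular. Define, for $k,l\le m$, - $\mathbf B^k_{j_1,\dots,j_m}=\mathbf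 b_{j_1,\dots,j_k}(\mathcal S_{j_1,\dots,j_m})$ ($k<M$), $\ \boldsymbol\Sigma_{j_1,\dots,j_m}=\mathrm{var}(y_M(\mathcal S_{j_1,\dots,j_m})\mid\mathcal E_{m-1})$ ($m\le M$), $\ \mathbf V_{j_1,\dots,j_m}=\mathrm{var}(y_M(\mathcal S_{j_1,\dots,j_m})\mid\mathcal E_{m})$ ($m<M$); - for $m<M$: $\mathbf A^{k,l}_{j_1,\dots,j_m}=\mathbf B^{k\,\prime}_{j_1,\dots,j_m}\mathbf V^{-1}_{j_1,\dots,j_m}\mathbf B^l_{j_1,\dots,j_m}$, $\ \boldsymbol\omega^m_{j_1,\dots,j_m}=\mathbf B^{m\,\prime}_{j_1,\dots,j_m}\mathbf V^{-1}_{j_1,\dots,j_m}y_M(\mathcal S_{j_1,\dots,j_m})$, $\ \widetilde{\mathbf K}_{j_1,\dots,j_m}=(\mathbf K^{-1}_{j_1,\dots,j_m}+\mathbf A^{m,m}_{j_1,\dots,j_m})^{-1}$; - $\mathbf L^l_{j_1,\dots,j_M}=\mathrm{cov}(y_M(\mathcal S^P_{j_1,\dots,j_M}),y_M(\mathcal S_{j_1,\dots,j_l})\mid\mathcal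 E_{l-1})$ for $l\le M$, so that $\mathbf L^M_{j_1,\dots,j_M}=v_M(\mathcal S^P_{j_1,\dots,j_M},\mathcal S_{j_1,\dots,j_M})$, and $\mathbf V^P_{j_1,\dots,j_M}=v_M(\mathcal S^P_{j_1,\dots,j_M},\mathcal S^P_{j_1,\dots,j_M})$; - the posterior basis-function matrices $\widetilde{\mathbf B}^{l,k}_{j_1,\dots,j_M}=\mathbf b_{j_1,\dots,j_k}(\mathcal S^P_{j_1,\dots,j_M})-\mathbf L^l_{j_1,\dots,j_M}\boldsymbol\Sigma^{-1}_{j_1,\dots,j_l}\mathbf B^k_{j_1,\dots,j_l}$ for $0\le k<l\le M$. All these conditional (co)variances are non-random: given $\mathcal E_{l-1}$, the covariance of $y_M(s)$ and $y_M(t)$ is $$\sum_{m=l}^{M-1}\ \sum_{j_1,\dots,j_m}\mathbf b_{j_1,\dots,j_m}(s)'\,\mathbf K_{j_1,\dots,j_m}\,\mathbf b_{j_1,\dots,j_m}(t)+v_M(s,t),$$ where $\mathbf b_{j_1,\dots,j_m}$ is extended by zero outside $\mathcal D_{j_1,\dots,j_m}$. All the inverses exist. **Proposition.** The posterior predictive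 distribution of $y_M(\mathcal S^P)$ given $y_M(\mathcal S)$ is, jointly for all finest regions $(j_1,\dots,j_M)$, the distribution of $$y_M(\mathcal S^P_{j_1,\dots,j_M})\mid y_M(\mathcal S)\ =\ \sum_{m=0}^{M-1}\widetilde{\mathbf B}^{m+1,m}_{j_1,\dots,j_M}\,\widetilde{\boldsymbol\eta}_{j_1,\dots,j_m}+\widetilde{\boldsymbol\delta}_{j_1,\dots,j_M},$$ where all the vectors $\widetilde{\boldsymbol\eta}_{j_1,\dots,j_m}$ ($m<M$) and $\widetilde{\boldsymbol\delta}_{j_1,\dots,j_M}$ are independent with $$\widetilde{\boldsymbol\eta}_{j_1,\dots,j_m}\sim N\big(\widetilde{\mathbf K}_{j_1,\dots,j_m}\boldsymbol\omega^m_{j_1,\dots,j_m},\ \widetilde{\mathbf K}_{j_1,\dots,j_m}\big),$$ $$\widetilde{\boldsymbol\delta}_{j_1,\dots,j_M}\sim N\big(\mathbf L^M_{j_1,\dots,j_M}\boldsymbol\Sigma^{-1}_{j_1,\dots,j_M}y_M(\mathcal S_{j_1,\dots,j_M}),\ \mathbf V^P_{j_1,\dots,j_M}-\mathbf L^M_{j_1,\dots,j_M}\boldsymbol\Sigma^{-1}_{j_1,\dots,j_M}\mathbf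 L^{M\,\prime}_{j_1,\dots,j_M}\big).$$ The covariance matrices of these distributions are positive semidefinite. Moreover, for all $0\le k<l<M$, $$\widetilde{\mathbf B}^{l,k}_{j_1,\dots,j_M}=\widetilde{\mathbf B}^{l+1,k}_{j_1,\dots,j_M}-\widetilde{\mathbf B}^{l+1,l}_{j_1,\dots,j_M}\,\widetilde{\mathbf K}_{j_1,\dots,j_l}\,\mathbf A^{l,k}_{j_1,\dots,j_l}.$$ -/

import Mathlib

open MeasureTheory ProbabilityTheory

/-- A recursive partitioning of the spatial domain `D` down to level `M`: the whole domain is the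
single region at level `0`, and each region at a level `m < M` is the disjoint union of `J`
subregions at level `m + 1`. The region with indices `j₁, …, jₘ` is `region m j`. (Regions may be
empty, so that a varying number of subregions is covered too.) -/
structure RecursivePartition (D : Type*) (J M : ℕ) where
  region : (m : ℕ) → (Fin m → Fin J) → Set D
  region_zero : ∀ j : Fin 0 → Fin J, region 0 j = Set.univ
  region_succ : ∀ m < M, ∀ j : Fin m → Fin J,
    region m j = ⋃ i : Fin J, region (m + 1) (Fin.snoc (α := fun _ => Fin J) j i)
  region_disjoint : ∀ m < M, ∀ (j : Fin m → Fin J) (i i' : Fin J), i ≠ i' →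
    Disjoint (region (m + 1) (Fin.snoc (α := fun _ => Fin J) j i))
      (region (m + 1) (Fin.snoc (α := fun _ => Fin J) j i'))

/-- The ingredients of a multi-resolution approximation: a covariance function `C₀` on `D`,
a recursive partitioning of `D`, and a finite set of knots in each region at levels `0, …, M - 1`.
(At level `M` the observation locations play the role of the knots.) -/
structure MRA (D : Type*) (J M : ℕ) extends RecursivePartition D J M where
  C₀ : D → D → ℝ
  C₀_posSemidef : ∀ F : Finset D, (Matrix.of fun s t : F => C₀ s t).PosSemidef
  knots : (m : ℕ) → (Fin m → Fin J) → Finset D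
  knots_mem : ∀ m < M, ∀ j : Fin m → Fin J, ∀ q ∈ knots m j, q ∈ region m j

namespace MRA

variable {D : Type*} [DecidableEq D] {J M : ℕ} (X : MRA D J M)

open Classical in
/-- The step from `v_m` (given as `v`) to `v_{m+1}`: subtract the predictive-process covariance
`b_{j₁…jₘ}(s)' K_{j₁…jₘ} b_{j₁…jₘ}(t)`, where `b(s) = v_m(s, Q)` on the region and
`K⁻¹ = v_m(Q, Q)`, and set the covariance between different regions at level `m + 1` to zero. -/
noncomputable def remainderStep (m : ℕ) (v : D → D → ℝ) (s t : D) : ℝ :=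
  if ∃ j : Fin (m + 1) → Fin J, s ∈ X.region (m + 1) j ∧ t ∈ X.region (m + 1) j then
    v s t - ∑ j : Fin m → Fin J,
      if s ∈ X.region m j ∧ t ∈ X.region m j then
        (fun q : X.knots m j => v s q) ⬝ᵥ
          Matrix.mulVec (Matrix.of fun p q : X.knots m j => v p q)⁻¹
            (fun q : X.knots m j => v t q)
      else 0
  else 0

/-- `v_m`, the covariance function of the remainder process `δ_m`. -/
noncomputable def v : ℕ → D → D → ℝ
  | 0 => X.C₀
  | m + 1 => X.remainderStep m (v m)

open Classical in
/-- The basis functions `b_{j₁…jₘ}(s) = v_m(s, Q_{j₁…jₘ})` for `s` in the region `j₁…jₘ`,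
extended by zero outside of the region. -/
noncomputable def b (m : ℕ) (j : Fin m → Fin J) (s : D) (q : X.knots m j) : ℝ :=
  if s ∈ X.region m j then X.v m s q else 0

/-- The prior precision matrix `K_{j₁…jₘ}⁻¹ = v_m(Q_{j₁…jₘ}, Q_{j₁…jₘ})` of the weights. -/
noncomputable def Kinv (m : ℕ) (j : Fin m → Fin J) : Matrix (X.knots m j) (X.knots m j) ℝ :=
  Matrix.of fun p q => X.v m p q

/-- The prior covariance matrix `K_{j₁…jₘ}` of the weights. -/
noncomputable def K (m : ℕ) (j : Fin m → Fin J) : Matrix (X.knots m j) (X.knots m j) ℝ :=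
  (X.Kinv m j)⁻¹

section RandomField

variable {Ω : Type*} [MeasurableSpace Ω]

/-- The prior model: the weight vectors `η_{j₁…jₘ} ∼ N(0, K_{j₁…jₘ})`, `m = 0, …, M - 1`, are
independent of each other and of the remainder `δ_M ∼ GP(0, v_M)`. -/
structure IsPrior (P : Measure Ω)
    (η : (m : Fin M) → (j : Fin m → Fin J) → Ω → EuclideanSpace ℝ (X.knots m j))
    (δ : D → Ω → ℝ) : Prop where
  measurable_weight : ∀ m j, Measurable (η m j)
  law_weight : ∀ m j, P.map (η m j) = multivariateGaussian 0 (X.K m j)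
  measurable_remainder : ∀ s, Measurable (δ s)
  gaussian_remainder : IsGaussianProcess δ P
  mean_remainder : ∀ s, ∫ ω, δ s ω ∂P = 0
  cov_remainder : ∀ s t, cov[δ s, δ t; P] = X.v M s t
  indep_weights : iIndepFun (fun (a : (m : Fin M) × (Fin m → Fin J)) => η a.1 a.2) P
  indep_remainder : IndepFun
    (fun ω (a : (m : Fin M) × (Fin m → Fin J)) => η a.1 a.2 ω) (fun ω s => δ s ω) P

/-- The `M`-RA process `y_M(s) = ∑_{m < M} b_{j₁…jₘ}(s)' η_{j₁…jₘ} + δ_M(s)`. At each level only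
the region that contains `s` contributes, because the basis functions vanish outside of their
region. -/
noncomputable def y
    (η : (m : Fin M) → (j : Fin m → Fin J) → Ω → EuclideanSpace ℝ (X.knots m j))
    (δ : D → Ω → ℝ) (s : D) (ω : Ω) : ℝ :=
  (∑ m : Fin M, ∑ j : Fin m → Fin J, X.b m j s ⬝ᵥ (η m j ω).ofLp) + δ s ω

/-- The σ-algebra generated by the weights at the levels `0, …, l - 1` (that is, by the set
`ℰ_{l-1}`; it is trivial for `l = 0`). -/
abbrev weightSigma
    (η : (m : Fin M) → (j : Fin m → Fin J) → Ω → EuclideanSpace ℝ (X.knots m j))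
    (l : ℕ) : MeasurableSpace Ω :=
  ⨆ (m : Fin M) (_ : (m : ℕ) < l) (j : Fin m → Fin J),
    MeasurableSpace.comap (η m j) inferInstance

end RandomField

/-- `cov(y_M(s), y_M(t) | ℰ_{l-1})`: the contribution of the levels `l, …, M - 1` and of the
remainder `δ_M` to the covariance of `y_M(s)` and `y_M(t)`. -/
noncomputable def covGiven (l : ℕ) (s t : D) : ℝ :=
  (∑ m ∈ Finset.Ico l M, ∑ j : Fin m → Fin J,
    X.b m j s ⬝ᵥ Matrix.mulVec (X.K m j) (X.b m j t)) + X.v M s t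

open Classical in
/-- The locations of a finite set `S` that lie in the region `j₁…jₘ`. -/
noncomputable def locs (S : Finset D) (m : ℕ) (j : Fin m → Fin J) : Finset D :=
  S.filter fun s => s ∈ X.region m j

open Classical in
/-- The part of a data vector on `S` that belongs to the region `j₁…jₘ`. -/
def dataAt (S : Finset D) (y : S → ℝ) (m : ℕ) (j : Fin m → Fin J) (s : X.locs S m j) : ℝ :=
  y ⟨s, (Finset.mem_filter.1 s.2).1⟩

section Matrices

variable (S SP : Finset D)

/-- `B^k_{j₁…jₘ} = b_{j₁…jₖ}(S_{j₁…jₘ})`, where `i = (j₁, …, jₖ)` and `j = (j₁, …, jₘ)`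
for some `k ≤ m`. -/
noncomputable def B {k m : ℕ} (i : Fin k → Fin J) (j : Fin m → Fin J) :
    Matrix (X.locs S m j) (X.knots k i) ℝ :=
  Matrix.of fun s => X.b k i s

/-- `Σ_{j₁…jₘ} = var(y_M(S_{j₁…jₘ}) | ℰ_{m-1})`. -/
noncomputable def Sig (m : ℕ) (j : Fin m → Fin J) : Matrix (X.locs S m j) (X.locs S m j) ℝ :=
  Matrix.of fun s t => X.covGiven m s t

/-- `V_{j₁…jₘ} = var(y_M(S_{j₁…jₘ}) | ℰ_m)`. -/
noncomputable def V (m : ℕ) (j : Fin m → Fin J) : Matrix (X.locs S m j) (X.locs S m j) ℝ :=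
  Matrix.of fun s t => X.covGiven (m + 1) s t

/-- `A^{k,l}_{j₁…jₘ} = (B^k_{j₁…jₘ})' V_{j₁…jₘ}⁻¹ B^l_{j₁…jₘ}`, where `i = (j₁, …, jₖ)`,
`i' = (j₁, …, j_l)` and `j = (j₁, …, jₘ)` for some `k, l ≤ m`. -/
noncomputable def A {k l m : ℕ} (i : Fin k → Fin J) (i' : Fin l → Fin J) (j : Fin m → Fin J) :
    Matrix (X.knots k i) (X.knots l i') ℝ :=
  (X.B S i j).transpose * (X.V S m j)⁻¹ * X.B S i' j

/-- `ω^m_{j₁…jₘ} = (B^m_{j₁…jₘ})' V_{j₁…jₘ}⁻¹ y_M(S_{j₁…jₘ})`. -/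
noncomputable def omega (y : S → ℝ) (m : ℕ) (j : Fin m → Fin J) : X.knots m j → ℝ :=
  Matrix.mulVec ((X.B S j j).transpose * (X.V S m j)⁻¹) (X.dataAt S y m j)

/-- The posterior precision matrix `K̃_{j₁…jₘ}⁻¹ = K_{j₁…jₘ}⁻¹ + A^{m,m}_{j₁…jₘ}`. -/
noncomputable def KtildeInv (m : ℕ) (j : Fin m → Fin J) :
    Matrix (X.knots m j) (X.knots m j) ℝ :=
  X.Kinv m j + X.A S j j j

/-- The posterior covariance matrix `K̃_{j₁…jₘ}`. -/
noncomputable def Ktilde (m : ℕ) (j : Fin m → Fin J) : Matrix (X.knots m j) (X.knots m j) ℝ :=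
  (X.KtildeInv S m j)⁻¹

/-- `L^l_{j₁…j_M} = cov(y_M(S^P_{j₁…j_M}), y_M(S_{j₁…j_l}) | ℰ_{l-1})` for `l ≤ M`. -/
noncomputable def L (l : ℕ) (hl : l ≤ M) (j : Fin M → Fin J) :
    Matrix (X.locs SP M j) (X.locs S l (Fin.take l hl j)) ℝ :=
  Matrix.of fun s t => X.covGiven l s t

/-- `L^M_{j₁…j_M} = v_M(S^P_{j₁…j_M}, S_{j₁…j_M})`. -/
noncomputable def LM (j : Fin M → Fin J) : Matrix (X.locs SP M j) (X.locs S M j) ℝ :=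
  Matrix.of fun s t => X.v M s t

/-- `V^P_{j₁…j_M} = v_M(S^P_{j₁…j_M}, S^P_{j₁…j_M})`. -/
noncomputable def VP (j : Fin M → Fin J) : Matrix (X.locs SP M j) (X.locs SP M j) ℝ :=
  Matrix.of fun s t => X.v M s t

/-- The posterior basis-function matrix
`B̃^{l,k}_{j₁…j_M} = b_{j₁…jₖ}(S^P_{j₁…j_M}) - L^l_{j₁…j_M} Σ_{j₁…j_l}⁻¹ B^k_{j₁…j_l}`
for `k < l ≤ M`. -/
noncomputable def Btilde (l k : ℕ) (hl : l ≤ M) (hk : k < l) (j : Fin M → Fin J) :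
    Matrix (X.locs SP M j) (X.knots k (Fin.take k (hk.le.trans hl) j)) ℝ :=
  (Matrix.of fun (s : X.locs SP M j) => X.b k (Fin.take k (hk.le.trans hl) j) s) -
    X.L S SP l hl j * (X.Sig S l (Fin.take l hl j))⁻¹ *
      X.B S (Fin.take k (hk.le.trans hl) j) (Fin.take l hl j)

/-- The mean `L^M Σ⁻¹ y_M(S_{j₁…j_M})` of `δ̃_{j₁…j_M}`. -/
noncomputable def deltaMean (y : S → ℝ) (j : Fin M → Fin J) : X.locs SP M j → ℝ :=
  Matrix.mulVec (X.LM S SP j * (X.Sig S M j)⁻¹) (X.dataAt S y M j)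

/-- The covariance matrix `V^P - L^M Σ⁻¹ (L^M)'` of `δ̃_{j₁…j_M}`. -/
noncomputable def deltaCov (j : Fin M → Fin J) : Matrix (X.locs SP M j) (X.locs SP M j) ℝ :=
  X.VP SP j - X.LM S SP j * (X.Sig S M j)⁻¹ * (X.LM S SP j).transpose

/-- The joint law of the posterior weights `η̃_{j₁…jₘ} ∼ N(K̃ ω^m, K̃)`, `m < M`, and the
fine-scale terms `δ̃_{j₁…j_M}`, all of them independent, given the data `y`. -/
noncomputable def posteriorComponents (y : S → ℝ) :
    Measure (((a : (m : Fin M) × (Fin m → Fin J)) → EuclideanSpace ℝ (X.knots a.1 a.2)) ×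
      ((j : Fin M → Fin J) → EuclideanSpace ℝ (X.locs SP M j))) :=
  (Measure.pi fun a : (m : Fin M) × (Fin m → Fin J) =>
      multivariateGaussian
        (WithLp.toLp 2 (Matrix.mulVec (X.Ktilde S a.1 a.2) (X.omega S y a.1 a.2)))
        (X.Ktilde S a.1 a.2)).prod
    (Measure.pi fun j : Fin M → Fin J =>
      multivariateGaussian (WithLp.toLp 2 (X.deltaMean S SP y j)) (X.deltaCov S SP j))

/-- The vectors `∑_{m < M} B̃^{m+1,m}_{j₁…j_M} η̃_{j₁…jₘ} + δ̃_{j₁…j_M}`, for all finest regions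
`j₁…j_M` jointly. -/
noncomputable def combine
    (z : ((a : (m : Fin M) × (Fin m → Fin J)) → EuclideanSpace ℝ (X.knots a.1 a.2)) ×
      ((j : Fin M → Fin J) → EuclideanSpace ℝ (X.locs SP M j)))
    (j : Fin M → Fin J) (s : X.locs SP M j) : ℝ :=
  (∑ m : Fin M, Matrix.mulVec
      (X.Btilde S SP ((m : ℕ) + 1) m m.isLt (Nat.lt_succ_self m) j)
      (z.1 ⟨m, Fin.take m m.isLt.le j⟩).ofLp s) + (z.2 j).ofLp s

end Matrices

end MRA

/-! ### Linear algebra: restriction to a block, and the Woodbury identities. -/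

section MatrixLemmas

open Matrix

variable {σ κ : Type*} [Fintype σ] [Fintype κ]

/-! Let `C_l` be the covariance function `covGiven l` of the process given the weights of the levels
below `l`. Three facts carry the argument: `C_0` is the unconditional covariance, `C_M = v_M`, and
`C_l` exceeds `C_{l+1}` by the finite-rank terms `b' K b` of the regions at level `l`. Moreover
`C_l` vanishes between different regions at level `l`, so the kriging predictor under `C_l` can be
computed from all data or from the data in the region of the location at any level `m ≤ l`
(`krig_eq_region`). This identifies `Σ` at level `l + 1` with `V` at level `l` for the purpose of
prediction.

Inside one region, the Woodbury identity compares kriging under `V` with kriging under `B K B' + V`: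
the predictor gains `b̃' K̃ ω` and the error covariance gains `b̃' K̃ b̃`, where `b̃ = b - B' V⁻¹ c`
and `c` is the vector of covariances with the data under `C_{l+1}` (`krig_succ`, `krigCov_succ`).
Telescoping over the levels splits the posterior mean and covariance into the contributions of the
`η̃` and a remainder under `v_M`, which is that of `δ̃`. The recursion for `B̃` is the same
predictor identity, with a column of basis-function values in place of the data.

On the probabilistic side, the kriging error is jointly Gaussian and uncorrelated with the data,
hence independent of them. The conditional law is therefore the law of predictor plus error
(`IsGaussianProcess.condDistrib_eq`). This law and that of the claimed sum are both Gaussian, so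
equality of means and covariances suffices (`map_krig_add_error_eq`). -/

theorem Matrix.dotProduct_comp_of_support {f g : σ → ℝ} {e : κ → σ} (he : Function.Injective e)
    (hf : ∀ t ∉ Set.range e, f t = 0) : (f ∘ e) ⬝ᵥ (g ∘ e) = f ⬝ᵥ g := by
  exact Fintype.sum_of_injective e he _ _ (fun t ht => by simp [hf t ht]) fun _ => rfl

/-- If the rows of `A` indexed by the range of `e` vanish outside of that range, then `A` can be
restricted to the range of `e` before it is applied. -/
theorem Matrix.submatrix_mulVec_comp {A : Matrix σ σ ℝ} {e : κ → σ} (he : Function.Injective e)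
    (hA : ∀ i, ∀ t ∉ Set.range e, A (e i) t = 0) (x : σ → ℝ) :
    A.submatrix e e *ᵥ (x ∘ e) = (A *ᵥ x) ∘ e := by
  funext i
  exact dotProduct_comp_of_support (f := fun t => A (e i) t) he (hA i)

/-- Since the block is decoupled from the rest, the restriction of the solution of `A z = x` solves
the restricted system. A principal submatrix of a positive definite matrix is invertible, so this
solution is unique. -/
theorem Matrix.inv_mulVec_comp [DecidableEq σ] [DecidableEq κ] {A : Matrix σ σ ℝ}
    (hA' : A.PosDef) {e : κ → σ} (he : Function.Injective e)
    (hA : ∀ i, ∀ t ∉ Set.range e, A (e i) t = 0) (x : σ → ℝ) :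
    (A⁻¹ *ᵥ x) ∘ e = (A.submatrix e e)⁻¹ *ᵥ (x ∘ e) := by
  have h1 : IsUnit A.det := (Matrix.isUnit_iff_isUnit_det _).1 hA'.isUnit
  have h2 : IsUnit (A.submatrix e e).det :=
    (Matrix.isUnit_iff_isUnit_det _).1 (hA'.submatrix he).isUnit
  have h := submatrix_mulVec_comp he hA (A⁻¹ *ᵥ x)
  rw [mulVec_mulVec, mul_nonsing_inv _ h1, one_mulVec] at h
  rw [← h, mulVec_mulVec, nonsing_inv_mul _ h2, one_mulVec]

/-- This localizes kriging: `A` is the covariance matrix of all data, the range of `e` is the data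
in one region, and `f` holds the covariances with a location of that region. -/
theorem Matrix.dotProduct_inv_mulVec_comp [DecidableEq σ] [DecidableEq κ] {A : Matrix σ σ ℝ}
    (hA' : A.PosDef) {e : κ → σ} (he : Function.Injective e)
    (hA : ∀ i, ∀ t ∉ Set.range e, A (e i) t = 0) (f x : σ → ℝ)
    (hf : ∀ t ∉ Set.range e, f t = 0) :
    f ⬝ᵥ A⁻¹ *ᵥ x = (f ∘ e) ⬝ᵥ (A.submatrix e e)⁻¹ *ᵥ (x ∘ e) := by
  rw [← inv_mulVec_comp hA' he hA, dotProduct_comp_of_support he hf]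

section Woodbury

variable {V : Matrix σ σ ℝ} {Kinv : Matrix κ κ ℝ} (B : Matrix σ κ ℝ)

theorem Matrix.PosDef.add_transpose_mul_inv_mul [DecidableEq σ] (hV : V.PosDef) (hK : Kinv.PosDef) :
    (Kinv + Bᵀ * V⁻¹ * B).PosDef := by
  have := hV.inv.posSemidef.conjTranspose_mul_mul_same B
  rw [conjTranspose_eq_transpose_of_trivial] at this
  exact hK.add_posSemidef this

theorem Matrix.PosDef.mul_inv_mul_transpose_add [DecidableEq κ] (hV : V.PosDef) (hK : Kinv.PosDef) :
    (B * Kinv⁻¹ * Bᵀ + V).PosDef := by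
  have := hK.inv.posSemidef.mul_mul_conjTranspose_same B
  rw [conjTranspose_eq_transpose_of_trivial] at this
  exact hV.posSemidef_add this

variable [DecidableEq σ] [DecidableEq κ]

/-- Kriging weights under the covariance `B K B' + V`, expressed through those under `V`. -/
theorem Matrix.woodbury_mulVec (hV : V.PosDef) (hK : Kinv.PosDef) (c : σ → ℝ) (b : κ → ℝ) :
    (B * Kinv⁻¹ * Bᵀ + V)⁻¹ *ᵥ (B *ᵥ (Kinv⁻¹ *ᵥ b) + c) =
      V⁻¹ *ᵥ c + V⁻¹ *ᵥ (B *ᵥ ((Kinv + Bᵀ * V⁻¹ * B)⁻¹ *ᵥ (b - Bᵀ *ᵥ (V⁻¹ *ᵥ c)))) := by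
  have hVu : IsUnit V.det := (Matrix.isUnit_iff_isUnit_det _).1 hV.isUnit
  have hKu : IsUnit Kinv.det := (Matrix.isUnit_iff_isUnit_det _).1 hK.isUnit
  have hTu : IsUnit (Kinv + Bᵀ * V⁻¹ * B).det :=
    (Matrix.isUnit_iff_isUnit_det _).1 (hV.add_transpose_mul_inv_mul B hK).isUnit
  have hSu : IsUnit (B * Kinv⁻¹ * Bᵀ + V).det :=
    (Matrix.isUnit_iff_isUnit_det _).1 (hV.mul_inv_mul_transpose_add B hK).isUnit
  set d := b - Bᵀ *ᵥ (V⁻¹ *ᵥ c) with hd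
  set u := (Kinv + Bᵀ * V⁻¹ * B)⁻¹ *ᵥ d with hu
  have h1 : Kinv *ᵥ u + Bᵀ *ᵥ (V⁻¹ *ᵥ (B *ᵥ u)) = d := by
    have : (Kinv + Bᵀ * V⁻¹ * B) *ᵥ u = d := by
      rw [hu, mulVec_mulVec, mul_nonsing_inv _ hTu, one_mulVec]
    simpa only [add_mulVec, ← mulVec_mulVec] using this
  -- The candidate is checked to solve the linear system. The equation `h1` for `u` is what removes
  -- the term `Bᵀ V⁻¹ B u`.
  have h2 : (B * Kinv⁻¹ * Bᵀ + V) *ᵥ (V⁻¹ *ᵥ c + V⁻¹ *ᵥ (B *ᵥ u)) =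
      B *ᵥ (Kinv⁻¹ *ᵥ b) + c := by
    have hVV : ∀ w, V *ᵥ (V⁻¹ *ᵥ w) = w := fun w => by
      rw [mulVec_mulVec, mul_nonsing_inv _ hVu, one_mulVec]
    have hKK : Kinv⁻¹ *ᵥ (Kinv *ᵥ u) = u := by
      rw [mulVec_mulVec, nonsing_inv_mul _ hKu, one_mulVec]
    have h3 : Bᵀ *ᵥ (V⁻¹ *ᵥ (B *ᵥ u)) = b - Bᵀ *ᵥ (V⁻¹ *ᵥ c) - Kinv *ᵥ u := by
      rw [← hd, ← h1]; abel
    simp only [add_mulVec, ← mulVec_mulVec, mulVec_add, hVV]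
    rw [h3]
    simp only [mulVec_sub, hKK]
    abel
  rw [← h2, mulVec_mulVec, nonsing_inv_mul _ hSu, one_mulVec]

theorem Matrix.PosDef.dotProduct_inv_mulVec_comm (hV : V.PosDef) (f g : σ → ℝ) :
    f ⬝ᵥ V⁻¹ *ᵥ g = (V⁻¹ *ᵥ f) ⬝ᵥ g := by
  rw [dotProduct_mulVec, ← mulVec_transpose]
  congr 2
  simpa [conjTranspose_eq_transpose_of_trivial] using hV.inv.isHermitian.eq

/-- The posterior mean under `B K B' + V`: the one under `V` plus the contribution of the
weights. -/
theorem Matrix.woodbury_dotProduct (hV : V.PosDef) (hK : Kinv.PosDef) (c g : σ → ℝ) (b : κ → ℝ) :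
    (B *ᵥ (Kinv⁻¹ *ᵥ b) + c) ⬝ᵥ (B * Kinv⁻¹ * Bᵀ + V)⁻¹ *ᵥ g =
      c ⬝ᵥ V⁻¹ *ᵥ g +
        (b - Bᵀ *ᵥ (V⁻¹ *ᵥ c)) ⬝ᵥ (Kinv + Bᵀ * V⁻¹ * B)⁻¹ *ᵥ (Bᵀ *ᵥ (V⁻¹ *ᵥ g)) := by
  rw [(hV.mul_inv_mul_transpose_add B hK).dotProduct_inv_mulVec_comm, woodbury_mulVec B hV hK,
    add_dotProduct, ← hV.dotProduct_inv_mulVec_comm, ← hV.dotProduct_inv_mulVec_comm,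
    (hV.add_transpose_mul_inv_mul B hK).dotProduct_inv_mulVec_comm, dotProduct_mulVec _ Bᵀ,
    vecMul_transpose]

/-- The posterior covariance under `B K B' + V`: the one under `V` plus the contribution of the
weights. -/
theorem Matrix.woodbury_covariance (hV : V.PosDef) (hK : Kinv.PosDef) (c c' : σ → ℝ)
    (b b' : κ → ℝ) :
    b ⬝ᵥ Kinv⁻¹ *ᵥ b' - (B *ᵥ (Kinv⁻¹ *ᵥ b) + c) ⬝ᵥ (B * Kinv⁻¹ * Bᵀ + V)⁻¹ *ᵥ
        (B *ᵥ (Kinv⁻¹ *ᵥ b') + c') =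
      (b - Bᵀ *ᵥ (V⁻¹ *ᵥ c)) ⬝ᵥ (Kinv + Bᵀ * V⁻¹ * B)⁻¹ *ᵥ (b' - Bᵀ *ᵥ (V⁻¹ *ᵥ c')) -
        c ⬝ᵥ V⁻¹ *ᵥ c' := by
  have hKu : IsUnit Kinv.det := (Matrix.isUnit_iff_isUnit_det _).1 hK.isUnit
  have hTu : IsUnit (Kinv + Bᵀ * V⁻¹ * B).det :=
    (Matrix.isUnit_iff_isUnit_det _).1 (hV.add_transpose_mul_inv_mul B hK).isUnit
  rw [woodbury_dotProduct B hV hK]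
  set d := b - Bᵀ *ᵥ (V⁻¹ *ᵥ c) with hd
  set d' := b' - Bᵀ *ᵥ (V⁻¹ *ᵥ c') with hd'
  -- Written this way, the inverse of `Kinv + Bᵀ V⁻¹ B` cancels on the first summand and leaves the
  -- prior term `Kinv⁻¹ b'`.
  have h1 : Bᵀ *ᵥ (V⁻¹ *ᵥ (B *ᵥ (Kinv⁻¹ *ᵥ b') + c')) =
      (Kinv + Bᵀ * V⁻¹ * B) *ᵥ (Kinv⁻¹ *ᵥ b') - d' := by
    have hKK : Kinv *ᵥ (Kinv⁻¹ *ᵥ b') = b' := by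
      rw [mulVec_mulVec, mul_nonsing_inv _ hKu, one_mulVec]
    rw [hd']
    simp only [add_mulVec, ← mulVec_mulVec, mulVec_add, hKK]
    abel
  have h2 : c ⬝ᵥ V⁻¹ *ᵥ (B *ᵥ (Kinv⁻¹ *ᵥ b')) = (b - d) ⬝ᵥ Kinv⁻¹ *ᵥ b' := by
    rw [hV.dotProduct_inv_mulVec_comm, hd, sub_sub_cancel, dotProduct_mulVec, mulVec_transpose]
  have h3 : (Kinv + Bᵀ * V⁻¹ * B)⁻¹ *ᵥ ((Kinv + Bᵀ * V⁻¹ * B) *ᵥ (Kinv⁻¹ *ᵥ b')) =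
      Kinv⁻¹ *ᵥ b' := by
    rw [mulVec_mulVec, nonsing_inv_mul _ hTu, one_mulVec]
  rw [h1, mulVec_sub _ _ d', h3, mulVec_add, dotProduct_add, h2, dotProduct_sub, sub_dotProduct]
  ring

end Woodbury

end MatrixLemmas

/-! ### Positive semidefinite kernels. -/

section Kernels

open Matrix

variable {D : Type*}

/-- A symmetric positive semidefinite function of two variables. -/
def IsPosSemidefKernel (v : D → D → ℝ) : Prop :=
  ∀ F : Finset D, (Matrix.of fun s t : F => v s t).PosSemidef

namespace IsPosSemidefKernel

variable {v w : D → D → ℝ}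

/-- Points may repeat; `schurComplement` needs this for two point sets that can overlap. -/
theorem posSemidef [DecidableEq D] (hv : IsPosSemidefKernel v) {ι : Type*} [Fintype ι]
    (f : ι → D) : (Matrix.of fun i j => v (f i) (f j)).PosSemidef :=
  (hv (Finset.univ.image f)).submatrix fun i : ι =>
    ⟨f i, Finset.mem_image_of_mem f (Finset.mem_univ i)⟩

theorem comm [DecidableEq D] (hv : IsPosSemidefKernel v) (s t : D) : v s t = v t s := by
  simpa using (hv.posSemidef ![t, s]).isHermitian.apply 0 1

theorem sum {ι : Type*} (I : Finset ι) {u : ι → D → D → ℝ}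
    (hu : ∀ i ∈ I, IsPosSemidefKernel (u i)) :
    IsPosSemidefKernel fun s t => ∑ i ∈ I, u i s t := by
  intro F
  convert! posSemidef_sum I (fun i hi => hu i hi F) using 1
  ext s t
  simp [Matrix.sum_apply]

/-- With `g` the indicator of a region, this cuts a kernel down to that region. -/
theorem mul_mul (hv : IsPosSemidefKernel v) (g : D → ℝ) :
    IsPosSemidefKernel fun s t => g s * v s t * g t := by
  classical
  intro F
  convert! (hv F).mul_mul_conjTranspose_same (Matrix.diagonal fun s : F => g s) using 1
  ext s t
  simp

theorem add (hv : IsPosSemidefKernel v) (hw : IsPosSemidefKernel w) :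
    IsPosSemidefKernel fun s t => v s t + w s t := fun F => (hv F).add (hw F)

theorem of_features {κ : Type*} [Fintype κ] {K : Matrix κ κ ℝ} (hK : K.PosSemidef)
    (b : D → κ → ℝ) : IsPosSemidefKernel fun s t => b s ⬝ᵥ K *ᵥ b t := by
  intro F
  convert! hK.mul_mul_conjTranspose_same (Matrix.of fun s : F => b s) using 1
  ext s t
  rw [Matrix.mul_assoc, Matrix.mul_apply]
  simp only [of_apply, dotProduct, mulVec, Matrix.mul_apply, conjTranspose_apply, star_trivial]

/-- On any `F`, the matrix in question is the Schur complement of the `Q` block in the positive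
semidefinite matrix of `v` on the disjoint sum of `F` and `Q`. -/
theorem schurComplement [DecidableEq D] (hv : IsPosSemidefKernel v) (Q : Finset D)
    (hQ : IsUnit (Matrix.of fun p q : Q => v p q)) :
    IsPosSemidefKernel fun s t => v s t -
      (fun q : Q => v s q) ⬝ᵥ (Matrix.of fun p q : Q => v p q)⁻¹ *ᵥ (fun q : Q => v t q) := by
  intro F
  have hQ' : (Matrix.of fun p q : Q => v p q).PosDef := (hv Q).posDef_iff_isUnit.2 hQ
  have := hQ'.isUnit.invertible
  have h := hv.posSemidef (Sum.elim (Subtype.val : F → D) (Subtype.val : Q → D))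
  have hb : (Matrix.of fun i j : F ⊕ Q => v (Sum.elim (Subtype.val : F → D) (Subtype.val : Q → D) i)
        (Sum.elim (Subtype.val : F → D) (Subtype.val : Q → D) j)) =
      fromBlocks (Matrix.of fun s t : F => v s t) (Matrix.of fun (s : F) (q : Q) => v s q)
        (Matrix.of fun (s : F) (q : Q) => v s q)ᴴ (Matrix.of fun p q : Q => v p q) := by
    ext (i | i) (j | j)
    · rfl
    · rfl
    · exact hv.comm _ _
    · rfl
  rw [hb, PosDef.fromBlocks₂₂ _ _ hQ'] at h
  convert! h using 1
  ext s t
  rw [Matrix.sub_apply, Matrix.mul_assoc, Matrix.mul_apply]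
  simp only [of_apply, dotProduct, mulVec, Matrix.mul_apply, conjTranspose_apply, star_trivial]

end IsPosSemidefKernel

end Kernels

/-! ### Nesting and uniqueness of regions. -/

namespace RecursivePartition

variable {D : Type*} {J M : ℕ} (X : RecursivePartition D J M)

theorem mem_region_succ {m : ℕ} (hm : m < M) {j : Fin m → Fin J} {s : D} :
    s ∈ X.region m j ↔ ∃ i : Fin J, s ∈ X.region (m + 1) (Fin.snoc (α := fun _ => Fin J) j i) := by
  rw [X.region_succ m hm, Set.mem_iUnion]

theorem exists_mem_region {m : ℕ} (hm : m ≤ M) (s : D) : ∃ j, s ∈ X.region m j := by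
  induction m with
  | zero => exact ⟨Fin.elim0, by simp [X.region_zero]⟩
  | succ m ih =>
    obtain ⟨j, hj⟩ := ih (by omega)
    obtain ⟨i, hi⟩ := (X.mem_region_succ hm).1 hj
    exact ⟨_, hi⟩

theorem mem_region_init {m : ℕ} (hm : m < M) {j : Fin (m + 1) → Fin J} {s : D}
    (hs : s ∈ X.region (m + 1) j) : s ∈ X.region m (Fin.init j) :=
  (X.mem_region_succ hm).2 ⟨j (Fin.last m), by rwa [Fin.snoc_init_self]⟩

/-- By induction the parents agree, and siblings with a common point coincide. The common point is
essential because regions may be empty. -/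
theorem region_unique {m : ℕ} (hm : m ≤ M) {j j' : Fin m → Fin J} {s : D}
    (hj : s ∈ X.region m j) (hj' : s ∈ X.region m j') : j = j' := by
  induction m with
  | zero => exact Subsingleton.elim _ _
  | succ m ih =>
    have h := ih (by omega) (X.mem_region_init hm hj) (X.mem_region_init hm hj')
    rw [← Fin.snoc_init_self j] at hj ⊢
    rw [← Fin.snoc_init_self j', ← h] at hj' ⊢
    by_contra hne
    exact Set.disjoint_left.1
      (X.region_disjoint m hm _ (j (Fin.last m)) (j' (Fin.last m)) fun h' => hne (by rw [h']))
      hj hj'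

theorem mem_region_take {m n : ℕ} (hmn : m ≤ n) (hn : n ≤ M) {j : Fin n → Fin J} {s : D}
    (hs : s ∈ X.region n j) : s ∈ X.region m (Fin.take m hmn j) := by
  induction n with
  | zero =>
    obtain rfl : m = 0 := by omega
    simpa using hs
  | succ n ih =>
    rcases hmn.eq_or_lt with rfl | h
    · simpa using hs
    · exact ih (by omega) (by omega) (X.mem_region_init hn hs)

/-- Two locations lie in a common region at level `m`. -/
def SameRegion (m : ℕ) (s t : D) : Prop := ∃ j, s ∈ X.region m j ∧ t ∈ X.region m j

theorem SameRegion.mono {X : RecursivePartition D J M} {m n : ℕ} (hmn : m ≤ n) (hn : n ≤ M)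
    {s t : D} (h : X.SameRegion n s t) : X.SameRegion m s t :=
  let ⟨_, hs, ht⟩ := h
  ⟨_, X.mem_region_take hmn hn hs, X.mem_region_take hmn hn ht⟩

theorem SameRegion.mem {X : RecursivePartition D J M} {m : ℕ} (hm : m ≤ M) {s t : D}
    (h : X.SameRegion m s t) {j : Fin m → Fin J} (hs : s ∈ X.region m j) : t ∈ X.region m j := by
  obtain ⟨i, hsi, hti⟩ := h
  rwa [X.region_unique hm hs hsi]

end RecursivePartition

/-! ### The remainder covariances and the conditional covariances of the process. -/

namespace MRA

variable {D : Type*} [DecidableEq D] {J M : ℕ} (X : MRA D J M)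

open Matrix

theorem v_zero_of_not_sameRegion {m : ℕ} {s t : D} (h : ¬ X.SameRegion m s t) :
    X.v m s t = 0 := by
  cases m with
  | zero => exact absurd ⟨Fin.elim0, by simp [X.region_zero]⟩ h
  | succ m => exact if_neg h

theorem b_of_notMem {m : ℕ} {j : Fin m → Fin J} {s : D} (h : s ∉ X.region m j) :
    X.b m j s = 0 := by
  funext q
  exact if_neg h

theorem v_succ_of_mem {m : ℕ} (hm : m < M) {j : Fin (m + 1) → Fin J} {s t : D}
    (hs : s ∈ X.region (m + 1) j) (ht : t ∈ X.region (m + 1) j) :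
    X.v (m + 1) s t = X.v m s t -
      (fun q : X.knots m (Fin.init j) => X.v m s q) ⬝ᵥ (X.K m (Fin.init j)) *ᵥ
        (fun q : X.knots m (Fin.init j) => X.v m t q) := by
  have hs' := X.mem_region_init hm hs
  have ht' := X.mem_region_init hm ht
  change remainderStep X m (X.v m) s t = _
  rw [remainderStep, if_pos ⟨j, hs, ht⟩, Finset.sum_eq_single (Fin.init j), if_pos ⟨hs', ht'⟩]
  · rfl
  · intro i _ hi
    rw [if_neg]
    exact fun h => hi (X.region_unique hm.le h.1 hs')
  · simp

theorem isPosSemidefKernel_v (hK : ∀ m < M, ∀ j : Fin m → Fin J, IsUnit (X.Kinv m j)) {m : ℕ}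
    (hm : m ≤ M) : IsPosSemidefKernel (X.v m) := by
  classical
  induction m with
  | zero => exact X.C₀_posSemidef
  | succ m ih =>
    have hm' : m < M := hm
    -- The next remainder covariance is a sum over the regions at level `m + 1` of Schur complements
    -- of `v_m` with respect to the parent's knots, each cut down by indicators. For a given pair of
    -- locations at most one term is nonzero.
    have h : IsPosSemidefKernel fun s t => ∑ j : Fin (m + 1) → Fin J,
        (if s ∈ X.region (m + 1) j then 1 else 0) * (X.v m s t -
          (fun q : X.knots m (Fin.init j) => X.v m s q) ⬝ᵥ
            (Matrix.of fun p q : X.knots m (Fin.init j) => X.v m p q)⁻¹ *ᵥ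
              (fun q : X.knots m (Fin.init j) => X.v m t q)) *
        (if t ∈ X.region (m + 1) j then 1 else 0) :=
      IsPosSemidefKernel.sum _ fun j _ =>
        ((ih hm'.le).schurComplement _ (hK m hm' (Fin.init j))).mul_mul _
    convert! h using 3 with s t
    by_cases hst : X.SameRegion (m + 1) s t
    · obtain ⟨j, hs, ht⟩ := hst
      rw [Finset.sum_eq_single j, X.v_succ_of_mem hm' hs ht]
      · simp [hs, ht]
        rfl
      · intro i _ hi
        rw [if_neg fun h => hi (X.region_unique hm h hs)]
        simp
      · simp
    · rw [X.v_zero_of_not_sameRegion hst, Finset.sum_eq_zero]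
      intro j _
      by_cases hs : s ∈ X.region (m + 1) j
      · rw [if_neg fun ht => hst ⟨j, hs, ht⟩]
        simp
      · simp [hs]

theorem posDef_Kinv (hK : ∀ m < M, ∀ j : Fin m → Fin J, IsUnit (X.Kinv m j)) {m : ℕ}
    (hm : m < M) (j : Fin m → Fin J) : (X.Kinv m j).PosDef :=
  (X.isPosSemidefKernel_v hK hm.le (X.knots m j)).posDef_iff_isUnit.2 (hK m hm j)

theorem posDef_K (hK : ∀ m < M, ∀ j : Fin m → Fin J, IsUnit (X.Kinv m j)) {m : ℕ}
    (hm : m < M) (j : Fin m → Fin J) : (X.K m j).PosDef :=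
  (X.posDef_Kinv hK hm j).inv

theorem covGiven_succ {l : ℕ} (hl : l < M) (s t : D) :
    X.covGiven l s t = (∑ j : Fin l → Fin J, X.b l j s ⬝ᵥ X.K l j *ᵥ X.b l j t) +
      X.covGiven (l + 1) s t := by
  rw [covGiven, covGiven, Finset.sum_eq_sum_Ico_succ_bot hl, add_assoc]

theorem covGiven_top : X.covGiven M = X.v M := by
  funext s t
  simp [covGiven]

theorem covGiven_succ_of_mem {l : ℕ} (hl : l < M) {j : Fin l → Fin J} {s : D}
    (hs : s ∈ X.region l j) (t : D) :
    X.covGiven l s t = X.b l j s ⬝ᵥ X.K l j *ᵥ X.b l j t + X.covGiven (l + 1) s t := by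
  rw [X.covGiven_succ hl, Finset.sum_eq_single j _ (by simp)]
  intro i _ hi
  rw [X.b_of_notMem fun h => hi (X.region_unique hl.le h hs), zero_dotProduct]

/-- Every remaining term lives inside single regions of a level at least `l`, and these are nested
in regions at level `l`. All localization below rests on this. -/
theorem covGiven_of_not_sameRegion {l : ℕ} (hl : l ≤ M) {s t : D} (h : ¬ X.SameRegion l s t) :
    X.covGiven l s t = 0 := by
  rw [covGiven, X.v_zero_of_not_sameRegion fun h' => h (h'.mono hl le_rfl), add_zero]
  refine Finset.sum_eq_zero fun m hm => Finset.sum_eq_zero fun j _ => ?_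
  rw [Finset.mem_Ico] at hm
  by_cases hs : s ∈ X.region m j
  · rw [X.b_of_notMem (s := t), mulVec_zero, dotProduct_zero]
    exact fun ht => h (RecursivePartition.SameRegion.mono hm.1 hm.2.le ⟨j, hs, ht⟩)
  · rw [X.b_of_notMem hs, zero_dotProduct]

theorem isPosSemidefKernel_covGiven
    (hK : ∀ m < M, ∀ j : Fin m → Fin J, IsUnit (X.Kinv m j)) (l : ℕ) :
    IsPosSemidefKernel (X.covGiven l) :=
  (IsPosSemidefKernel.sum _ fun _ hm => IsPosSemidefKernel.sum _ fun _ _ =>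
    IsPosSemidefKernel.of_features (X.posDef_K hK (Finset.mem_Ico.1 hm).2 _).posSemidef _).add
      (X.isPosSemidefKernel_v hK le_rfl)

/-! ### Kriging: localization to regions and recursion over the levels. -/

section Locations

variable (S : Finset D)

omit [DecidableEq D] in
variable {S} in
theorem mem_locs {m : ℕ} {j : Fin m → Fin J} {s : D} :
    s ∈ X.locs S m j ↔ s ∈ S ∧ s ∈ X.region m j := by
  classical
  exact Finset.mem_filter

/-- The inclusion of the locations in a region into all locations. -/
def locsIncl (m : ℕ) (j : Fin m → Fin J) (s : X.locs S m j) : S := ⟨s, (X.mem_locs.1 s.2).1⟩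

omit [DecidableEq D] in
theorem locsIncl_injective (m : ℕ) (j : Fin m → Fin J) :
    Function.Injective (X.locsIncl S m j) := fun _ _ h =>
  Subtype.ext (congrArg (fun s : S => (s : D)) h)

omit [DecidableEq D] in
theorem mem_region_of_mem_locs {m : ℕ} {j : Fin m → Fin J} (s : X.locs S m j) :
    (s : D) ∈ X.region m j := (X.mem_locs.1 s.2).2

omit [DecidableEq D] in
theorem mem_range_locsIncl {m : ℕ} {j : Fin m → Fin J} {s : S} :
    s ∈ Set.range (X.locsIncl S m j) ↔ (s : D) ∈ X.region m j := by
  refine ⟨?_, fun h => ⟨⟨s, X.mem_locs.2 ⟨s.2, h⟩⟩, rfl⟩⟩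
  rintro ⟨t, rfl⟩
  exact X.mem_region_of_mem_locs S t

/-- The covariance matrix of `y_M(S)` given the weights at the levels below `l`. -/
noncomputable def gram (l : ℕ) : Matrix S S ℝ := Matrix.of fun s t => X.covGiven l s t

theorem Sig_eq_submatrix (m : ℕ) (j : Fin m → Fin J) :
    X.Sig S m j = (X.gram S m).submatrix (X.locsIncl S m j) (X.locsIncl S m j) := rfl

theorem V_eq_submatrix (m : ℕ) (j : Fin m → Fin J) :
    X.V S m j = (X.gram S (m + 1)).submatrix (X.locsIncl S m j) (X.locsIncl S m j) := rfl

variable {S}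

/-- This supplies the support hypotheses of the restriction lemmas, for regions of any level coarser
than or equal to `l`. -/
theorem covGiven_eq_zero_of_notMem_range {m l : ℕ} (hml : m ≤ l) (hl : l ≤ M)
    {j : Fin m → Fin J} {s : D} (hs : s ∈ X.region m j) {t : S}
    (ht : t ∉ Set.range (X.locsIncl S m j)) : X.covGiven l s t = 0 := by
  refine X.covGiven_of_not_sameRegion hl fun h => ht ?_
  exact (X.mem_range_locsIncl S).2 ((h.mono hml hl).mem (hml.trans hl) hs)

/-- The matrix of `v_M` on `S` is block diagonal over the finest regions with invertible blocks, so
it is injective; being positive semidefinite, it is positive definite. The levels from `l` on only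
add positive semidefinite terms. -/
theorem posDef_gram (hK : ∀ m < M, ∀ j : Fin m → Fin J, IsUnit (X.Kinv m j))
    (hS : ∀ j : Fin M → Fin J, IsUnit (Matrix.of fun s t : X.locs S M j => X.v M s t)) (l : ℕ) :
    (X.gram S l).PosDef := by
  have hM : (Matrix.of fun s t : S => X.v M s t).PosDef := by
    refine (X.isPosSemidefKernel_v hK le_rfl S).posDef_iff_isUnit.2 ?_
    rw [← Matrix.mulVec_injective_iff_isUnit]
    refine (injective_iff_map_eq_zero (Matrix.mulVecLin _)).2 fun x hx => ?_
    funext s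
    obtain ⟨j, hj⟩ := X.exists_mem_region le_rfl (s : D)
    have h := Matrix.submatrix_mulVec_comp (A := Matrix.of fun s t : S => X.v M s t)
      (X.locsIncl_injective S M j) (fun i t ht => by
        have := X.covGiven_eq_zero_of_notMem_range le_rfl le_rfl (X.mem_region_of_mem_locs S i) ht
        rwa [covGiven_top] at this) x
    rw [Matrix.mulVecLin_apply] at hx
    rw [hx] at h
    obtain ⟨s', rfl⟩ := (X.mem_range_locsIncl S).2 hj
    have h0 : x ∘ X.locsIncl S M j = 0 :=
      (Matrix.mulVec_injective_iff_isUnit.2 (hS j)) (h.trans (Matrix.mulVec_zero _).symm)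
    exact congrFun h0 s'
  have hsum : IsPosSemidefKernel fun s t => ∑ m ∈ Finset.Ico l M, ∑ j : Fin m → Fin J,
      X.b m j s ⬝ᵥ X.K m j *ᵥ X.b m j t :=
    IsPosSemidefKernel.sum _ fun _ hm => IsPosSemidefKernel.sum _ fun _ _ =>
      IsPosSemidefKernel.of_features (X.posDef_K hK (Finset.mem_Ico.1 hm).2 _).posSemidef _
  exact hM.posSemidef_add (hsum S)

theorem posDef_Sig (hK : ∀ m < M, ∀ j : Fin m → Fin J, IsUnit (X.Kinv m j))
    (hS : ∀ j : Fin M → Fin J, IsUnit (Matrix.of fun s t : X.locs S M j => X.v M s t))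
    (m : ℕ) (j : Fin m → Fin J) : (X.Sig S m j).PosDef := by
  rw [Sig_eq_submatrix]
  exact (X.posDef_gram hK hS m).submatrix (X.locsIncl_injective S m j)

theorem posDef_V (hK : ∀ m < M, ∀ j : Fin m → Fin J, IsUnit (X.Kinv m j))
    (hS : ∀ j : Fin M → Fin J, IsUnit (Matrix.of fun s t : X.locs S M j => X.v M s t))
    (m : ℕ) (j : Fin m → Fin J) : (X.V S m j).PosDef := by
  rw [V_eq_submatrix]
  exact (X.posDef_gram hK hS (m + 1)).submatrix (X.locsIncl_injective S m j)

theorem posDef_KtildeInv (hK : ∀ m < M, ∀ j : Fin m → Fin J, IsUnit (X.Kinv m j))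
    (hS : ∀ j : Fin M → Fin J, IsUnit (Matrix.of fun s t : X.locs S M j => X.v M s t))
    {m : ℕ} (hm : m < M) (j : Fin m → Fin J) : (X.KtildeInv S m j).PosDef :=
  (X.posDef_V hK hS m j).add_transpose_mul_inv_mul _ (X.posDef_Kinv hK hm j)

theorem posSemidef_deltaCov (hK : ∀ m < M, ∀ j : Fin m → Fin J, IsUnit (X.Kinv m j))
    (hS : ∀ j : Fin M → Fin J, IsUnit (Matrix.of fun s t : X.locs S M j => X.v M s t))
    (SP : Finset D) (j : Fin M → Fin J) : (X.deltaCov S SP j).PosSemidef := by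
  have h := (X.isPosSemidefKernel_v hK le_rfl).schurComplement _ (hS j) (X.locs SP M j)
  convert! h using 1
  ext s t
  rw [deltaCov, Matrix.sub_apply, Matrix.mul_assoc, Matrix.mul_apply, Sig, covGiven_top]
  simp only [of_apply, dotProduct, mulVec, Matrix.mul_apply, transpose_apply, VP, LM]

/-- The kriging predictor at `s` from data `y` on `S`, under the covariance function of `y_M` given
the weights at the levels below `l`. -/
noncomputable def krig (l : ℕ) (s : D) (y : S → ℝ) : ℝ :=
  (fun t : S => X.covGiven l s t) ⬝ᵥ (X.gram S l)⁻¹ *ᵥ y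

/-- The matrix on the right is `Σ` at level `l` if `m = l`, and `V` at level `m` if `l = m + 1`.
Defining `krig` with all data thus lets the two be exchanged, and avoids following regions from one
level to the next. -/
theorem krig_eq_region (hK : ∀ m < M, ∀ j : Fin m → Fin J, IsUnit (X.Kinv m j))
    (hS : ∀ j : Fin M → Fin J, IsUnit (Matrix.of fun s t : X.locs S M j => X.v M s t))
    {m l : ℕ} (hml : m ≤ l) (hl : l ≤ M) {j : Fin m → Fin J} {s : D} (hs : s ∈ X.region m j)
    (y : S → ℝ) :
    X.krig l s y = (fun t : X.locs S m j => X.covGiven l s t) ⬝ᵥ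
      ((X.gram S l).submatrix (X.locsIncl S m j) (X.locsIncl S m j))⁻¹ *ᵥ
        (y ∘ X.locsIncl S m j) :=
  Matrix.dotProduct_inv_mulVec_comp (X.posDef_gram hK hS l) (X.locsIncl_injective S m j)
    (fun i _ ht => X.covGiven_eq_zero_of_notMem_range hml hl (X.mem_region_of_mem_locs S i) ht)
    _ _ fun _ ht => X.covGiven_eq_zero_of_notMem_range hml hl hs ht

theorem krig_eq_zero (hK : ∀ m < M, ∀ j : Fin m → Fin J, IsUnit (X.Kinv m j))
    (hS : ∀ j : Fin M → Fin J, IsUnit (Matrix.of fun s t : X.locs S M j => X.v M s t))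
    {m l : ℕ} (hml : m ≤ l) (hl : l ≤ M) {s : D} {y : S → ℝ}
    (hy : ∀ t : S, X.SameRegion m s t → y t = 0) : X.krig l s y = 0 := by
  obtain ⟨j, hj⟩ := X.exists_mem_region (hml.trans hl) s
  have h0 : y ∘ X.locsIncl S m j = 0 :=
    funext fun t => hy _ ⟨j, hj, X.mem_region_of_mem_locs S t⟩
  rw [X.krig_eq_region hK hS hml hl hj, h0, mulVec_zero, dotProduct_zero]

variable (S) in
/-- The posterior basis functions `b̃ = b - L Σ⁻¹ B` of the region `i` at level `m`. -/
noncomputable def postBasis (m : ℕ) (i : Fin m → Fin J) (s : D) (q : X.knots m i) : ℝ :=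
  X.b m i s q - X.krig (m + 1) s fun t : S => X.b m i t q

/-- Only the data in the level-`m` region of `s` enter the predictor, and the basis functions of
another region vanish there. -/
theorem postBasis_of_notMem (hK : ∀ m < M, ∀ j : Fin m → Fin J, IsUnit (X.Kinv m j))
    (hS : ∀ j : Fin M → Fin J, IsUnit (Matrix.of fun s t : X.locs S M j => X.v M s t))
    {m : ℕ} (hm : m < M) {i : Fin m → Fin J} {s : D} (hs : s ∉ X.region m i) :
    X.postBasis S m i s = 0 := by
  funext q
  rw [postBasis, X.b_of_notMem hs, X.krig_eq_zero hK hS m.le_succ hm, Pi.zero_apply, sub_zero]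
  rintro t ⟨j, hsj, htj⟩
  have ht : (t : D) ∉ X.region m i := fun ht => hs (by rwa [X.region_unique hm.le ht htj])
  simp only [X.b_of_notMem ht, Pi.zero_apply]

/-- This is the combination `b - Bᵀ V⁻¹ c` of the Woodbury identities; `V` appears because the
predictor at level `m + 1` is localized to the coarser region at level `m`. -/
theorem postBasis_of_mem (hK : ∀ m < M, ∀ j : Fin m → Fin J, IsUnit (X.Kinv m j))
    (hS : ∀ j : Fin M → Fin J, IsUnit (Matrix.of fun s t : X.locs S M j => X.v M s t))
    {m : ℕ} (hm : m < M) {i : Fin m → Fin J} {s : D} (hs : s ∈ X.region m i) :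
    X.postBasis S m i s = X.b m i s - (X.B S i i)ᵀ *ᵥ ((X.V S m i)⁻¹ *ᵥ
      fun t : X.locs S m i => X.covGiven (m + 1) s t) := by
  funext q
  rw [postBasis, X.krig_eq_region hK hS m.le_succ hm hs, ← V_eq_submatrix,
    (X.posDef_V hK hS m i).dotProduct_inv_mulVec_comm, dotProduct_comm]
  rfl

theorem Sig_eq (hm : m < M) (i : Fin m → Fin J) :
    X.Sig S m i = X.B S i i * (X.Kinv m i)⁻¹ * (X.B S i i)ᵀ + X.V S m i := by
  ext s t
  rw [Matrix.add_apply, Matrix.mul_assoc, Matrix.mul_apply, Sig, of_apply,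
    X.covGiven_succ_of_mem hm (X.mem_region_of_mem_locs S s)]
  simp only [dotProduct, mulVec, Matrix.mul_apply, transpose_apply, B, of_apply, V, K]

theorem covGiven_eq_mulVec_add {m : ℕ} (hm : m < M) {i : Fin m → Fin J} {s : D}
    (hs : s ∈ X.region m i) (hK : (X.Kinv m i).PosDef) :
    (fun t : X.locs S m i => X.covGiven m s t) =
      X.B S i i *ᵥ ((X.Kinv m i)⁻¹ *ᵥ X.b m i s) +
        fun t : X.locs S m i => X.covGiven (m + 1) s t := by
  funext t
  rw [X.covGiven_succ_of_mem hm hs, K, hK.dotProduct_inv_mulVec_comm, dotProduct_comm]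
  rfl

/-- Woodbury in the region `i`, where the weights of level `m` turn the data covariance `V` into `B
K Bᵀ + V = Σ`. As `y` is arbitrary, the identity serves the posterior mean and the recursion for
`B̃` alike. -/
theorem krig_succ (hK : ∀ m < M, ∀ j : Fin m → Fin J, IsUnit (X.Kinv m j))
    (hS : ∀ j : Fin M → Fin J, IsUnit (Matrix.of fun s t : X.locs S M j => X.v M s t))
    {m : ℕ} (hm : m < M) {i : Fin m → Fin J} {s : D} (hs : s ∈ X.region m i) (y : S → ℝ) :
    X.krig m s y = X.krig (m + 1) s y + X.postBasis S m i s ⬝ᵥ X.Ktilde S m i *ᵥ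
      ((X.B S i i)ᵀ *ᵥ ((X.V S m i)⁻¹ *ᵥ (y ∘ X.locsIncl S m i))) := by
  rw [X.krig_eq_region hK hS le_rfl hm.le hs, X.krig_eq_region hK hS m.le_succ hm hs,
    ← Sig_eq_submatrix, ← V_eq_submatrix, X.Sig_eq hm,
    X.covGiven_eq_mulVec_add hm hs (X.posDef_Kinv hK hm i),
    woodbury_dotProduct _ (X.posDef_V hK hS m i) (X.posDef_Kinv hK hm i),
    X.postBasis_of_mem hK hS hm hs]
  rfl

variable (S) in
/-- The covariance of the prediction errors at `s` and `t` of the kriging predictor. -/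
noncomputable def krigCov (l : ℕ) (s t : D) : ℝ :=
  X.covGiven l s t - X.krig l s fun u : S => X.covGiven l t u

/-- The predictor at `s` uses only data in the region of `s`, and these are uncorrelated with `t`.
-/
theorem krigCov_of_not_sameRegion (hK : ∀ m < M, ∀ j : Fin m → Fin J, IsUnit (X.Kinv m j))
    (hS : ∀ j : Fin M → Fin J, IsUnit (Matrix.of fun s t : X.locs S M j => X.v M s t))
    {m l : ℕ} (hml : m ≤ l) (hl : l ≤ M) {s t : D} (h : ¬ X.SameRegion m s t) :
    X.krigCov S l s t = 0 := by
  rw [krigCov, X.covGiven_of_not_sameRegion hl fun h' => h (h'.mono hml hl),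
    X.krig_eq_zero hK hS hml hl, sub_zero]
  rintro u ⟨j, hs, hu⟩
  refine X.covGiven_of_not_sameRegion hl fun h' => h ⟨j, hs, ?_⟩
  obtain ⟨i, ht, hu'⟩ := h'.mono hml hl
  rwa [X.region_unique (hml.trans hl) hu hu']

/-- For locations in a common region `i` this is `woodbury_covariance`, with only `i` contributing
to the sum. Otherwise every term vanishes. -/
theorem krigCov_succ (hK : ∀ m < M, ∀ j : Fin m → Fin J, IsUnit (X.Kinv m j))
    (hS : ∀ j : Fin M → Fin J, IsUnit (Matrix.of fun s t : X.locs S M j => X.v M s t))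
    {m : ℕ} (hm : m < M) (s t : D) :
    X.krigCov S m s t = X.krigCov S (m + 1) s t + ∑ i : Fin m → Fin J,
      X.postBasis S m i s ⬝ᵥ X.Ktilde S m i *ᵥ X.postBasis S m i t := by
  by_cases h : X.SameRegion m s t
  · obtain ⟨i, hs, ht⟩ := h
    rw [Finset.sum_eq_single i _ (by simp)]
    · rw [krigCov, krigCov, X.krig_eq_region hK hS le_rfl hm.le hs,
        X.krig_eq_region hK hS m.le_succ hm hs, ← Sig_eq_submatrix, ← V_eq_submatrix, X.Sig_eq hm,
        X.covGiven_succ_of_mem hm hs]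
      have hc : ∀ l r, ((fun u : S => X.covGiven l r u) ∘ X.locsIncl S m i) =
        fun u : X.locs S m i => X.covGiven l r u := fun _ _ => rfl
      have hw := woodbury_covariance (X.B S i i) (X.posDef_V hK hS m i) (X.posDef_Kinv hK hm i)
        (fun u : X.locs S m i => X.covGiven (m + 1) s u)
        (fun u : X.locs S m i => X.covGiven (m + 1) t u) (X.b m i s) (X.b m i t)
      rw [← X.covGiven_eq_mulVec_add hm hs (X.posDef_Kinv hK hm i),
        ← X.covGiven_eq_mulVec_add hm ht (X.posDef_Kinv hK hm i),
        ← X.postBasis_of_mem hK hS hm hs, ← X.postBasis_of_mem hK hS hm ht] at hw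
      change _ = _ ⬝ᵥ X.Ktilde S m i *ᵥ _ - _ at hw
      change X.b m i s ⬝ᵥ X.K m i *ᵥ _ - _ = _ at hw
      rw [hc, hc]
      linarith
    · intro j _ hj
      rw [X.postBasis_of_notMem hK hS hm fun h => hj (X.region_unique hm.le h hs), zero_dotProduct]
  · rw [X.krigCov_of_not_sameRegion hK hS le_rfl hm.le h,
      X.krigCov_of_not_sameRegion hK hS m.le_succ hm h, Finset.sum_eq_zero, add_zero]
    intro j _
    by_cases hs : s ∈ X.region m j
    · rw [X.postBasis_of_notMem hK hS hm (s := t) fun ht => h ⟨j, hs, ht⟩, mulVec_zero,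
        dotProduct_zero]
    · rw [X.postBasis_of_notMem hK hS hm hs, zero_dotProduct]

theorem krig_zero_eq_sum (hK : ∀ m < M, ∀ j : Fin m → Fin J, IsUnit (X.Kinv m j))
    (hS : ∀ j : Fin M → Fin J, IsUnit (Matrix.of fun s t : X.locs S M j => X.v M s t))
    (s : D) (y : S → ℝ) :
    X.krig 0 s y = (∑ m : Fin M, ∑ i : Fin m → Fin J,
      X.postBasis S m i s ⬝ᵥ X.Ktilde S m i *ᵥ X.omega S y m i) + X.krig M s y := by
  rw [Fin.sum_univ_eq_sum_range (fun m => ∑ i : Fin m → Fin J,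
    X.postBasis S m i s ⬝ᵥ X.Ktilde S m i *ᵥ X.omega S y m i), ← sub_eq_iff_eq_add,
    -- The difference of the predictors at levels `0` and `M` telescopes, which leaves `krig_succ`
    -- for each level.
    ← Finset.sum_range_sub' (fun m => X.krig m s y)]
  refine Finset.sum_congr rfl fun m hm => ?_
  have hm : m < M := Finset.mem_range.1 hm
  obtain ⟨i, hi⟩ := X.exists_mem_region hm.le s
  rw [sub_eq_iff_eq_add', X.krig_succ hK hS hm hi, Finset.sum_eq_single i _ (by simp), omega,
    ← mulVec_mulVec]
  · rfl
  · intro j _ hj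
    rw [X.postBasis_of_notMem hK hS hm fun h => hj (X.region_unique hm.le h hi), zero_dotProduct]

theorem krigCov_zero_eq_sum (hK : ∀ m < M, ∀ j : Fin m → Fin J, IsUnit (X.Kinv m j))
    (hS : ∀ j : Fin M → Fin J, IsUnit (Matrix.of fun s t : X.locs S M j => X.v M s t))
    (s t : D) :
    X.krigCov S 0 s t = (∑ m : Fin M, ∑ i : Fin m → Fin J,
      X.postBasis S m i s ⬝ᵥ X.Ktilde S m i *ᵥ X.postBasis S m i t) + X.krigCov S M s t := by
  rw [Fin.sum_univ_eq_sum_range (fun m => ∑ i : Fin m → Fin J,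
    X.postBasis S m i s ⬝ᵥ X.Ktilde S m i *ᵥ X.postBasis S m i t), ← sub_eq_iff_eq_add,
    ← Finset.sum_range_sub' (fun m => X.krigCov S m s t)]
  refine Finset.sum_congr rfl fun m hm => ?_
  rw [sub_eq_iff_eq_add', X.krigCov_succ hK hS (Finset.mem_range.1 hm)]

theorem deltaMean_eq_krig (hK : ∀ m < M, ∀ j : Fin m → Fin J, IsUnit (X.Kinv m j))
    (hS : ∀ j : Fin M → Fin J, IsUnit (Matrix.of fun s t : X.locs S M j => X.v M s t))
    (SP : Finset D) (y : S → ℝ) (j : Fin M → Fin J) (s : X.locs SP M j) :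
    X.deltaMean S SP y j s = X.krig M s y := by
  rw [X.krig_eq_region hK hS le_rfl le_rfl (X.mem_region_of_mem_locs SP s), deltaMean,
    ← mulVec_mulVec, covGiven_top]
  rfl

theorem deltaCov_eq_krigCov (hK : ∀ m < M, ∀ j : Fin m → Fin J, IsUnit (X.Kinv m j))
    (hS : ∀ j : Fin M → Fin J, IsUnit (Matrix.of fun s t : X.locs S M j => X.v M s t))
    (SP : Finset D) (j : Fin M → Fin J) (s t : X.locs SP M j) :
    X.deltaCov S SP j s t = X.krigCov S M s t := by
  rw [krigCov, X.krig_eq_region hK hS le_rfl le_rfl (X.mem_region_of_mem_locs SP s), deltaCov,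
    covGiven_top, Matrix.sub_apply, Matrix.mul_assoc, Matrix.mul_apply]
  simp only [dotProduct, mulVec, Matrix.mul_apply, transpose_apply]
  rfl

theorem Btilde_apply (hK : ∀ m < M, ∀ j : Fin m → Fin J, IsUnit (X.Kinv m j))
    (hS : ∀ j : Fin M → Fin J, IsUnit (Matrix.of fun s t : X.locs S M j => X.v M s t))
    (SP : Finset D) (l k : ℕ) (hl : l ≤ M) (hk : k < l) (j : Fin M → Fin J)
    (s : X.locs SP M j) (q : X.knots k (Fin.take k (hk.le.trans hl) j)) :
    X.Btilde S SP l k hl hk j s q = X.b k (Fin.take k (hk.le.trans hl) j) s q -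
      X.krig l s fun t : S => X.b k (Fin.take k (hk.le.trans hl) j) t q := by
  rw [X.krig_eq_region hK hS le_rfl hl
    (X.mem_region_take hl le_rfl (X.mem_region_of_mem_locs SP s)), Btilde,
    Matrix.sub_apply, Matrix.mul_assoc, Matrix.mul_apply]
  simp only [dotProduct, mulVec, Matrix.mul_apply]
  rfl

/-- Each entry is `krig_succ` with a column of `b` at level `k` as the data, for which the analogue
of `ω` is a column of `A`. -/
theorem Btilde_succ (hK : ∀ m < M, ∀ j : Fin m → Fin J, IsUnit (X.Kinv m j))
    (hS : ∀ j : Fin M → Fin J, IsUnit (Matrix.of fun s t : X.locs S M j => X.v M s t))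
    (SP : Finset D) (l k : ℕ) (hl : l < M) (hk : k < l) (j : Fin M → Fin J) :
    X.Btilde S SP l k hl.le hk j =
      X.Btilde S SP (l + 1) k hl (hk.trans (Nat.lt_succ_self l)) j -
        X.Btilde S SP (l + 1) l hl (Nat.lt_succ_self l) j *
          X.Ktilde S l (Fin.take l hl.le j) *
          X.A S (Fin.take l hl.le j) (Fin.take k (hk.le.trans hl.le) j) (Fin.take l hl.le j) := by
  ext s q
  have hB : X.Btilde S SP (l + 1) l hl (Nat.lt_succ_self l) j s =
      X.postBasis S l (Fin.take l hl.le j) s :=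
    funext fun p => X.Btilde_apply hK hS SP (l + 1) l hl (Nat.lt_succ_self l) j s p
  rw [Matrix.sub_apply, X.Btilde_apply hK hS, X.Btilde_apply hK hS, Matrix.mul_assoc,
    Matrix.mul_apply_eq_vecMul, hB, X.krig_succ hK hS hl
      (X.mem_region_take hl.le le_rfl (X.mem_region_of_mem_locs SP s)), ← sub_sub]
  congr 1
  simp only [A, Matrix.mul_assoc, vecMul, dotProduct, mulVec, Matrix.mul_apply]
  rfl

end Locations

end MRA

/-! ### Gaussian measures and conditional distributions. -/

section GaussianLemmas

open Matrix

variable {Ω : Type*} [MeasurableSpace Ω] {P : Measure Ω}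

/-- Two Gaussian measures are equal if the means and the covariances of functionals that span the
dual space agree. -/
theorem ProbabilityTheory.IsGaussian.ext_of_dual_span {E : Type*} [NormedAddCommGroup E]
    [NormedSpace ℝ E] [MeasurableSpace E] [BorelSpace E] [SecondCountableTopology E]
    [CompleteSpace E] {μ ν : Measure E} [IsGaussian μ] [IsGaussian ν] {ι : Type*} [Fintype ι]
    (e : ι → StrongDual ℝ E) (he : ∀ L : StrongDual ℝ E, ∃ c : ι → ℝ, L = ∑ i, c i • e i)
    (hm : ∀ i, ∫ x, e i x ∂μ = ∫ x, e i x ∂ν)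
    (hc : ∀ i j, cov[e i, e j; μ] = cov[e i, e j; ν]) : μ = ν := by
  -- A Gaussian characteristic function at `L` depends only on the mean and variance of `L`, and
  -- these expand linearly and bilinearly in the coefficients `c`.
  apply Measure.ext_of_charFunDual
  ext L
  obtain ⟨c, rfl⟩ := he L
  have hL : ⇑(∑ i, c i • e i) = fun x => ∑ i, c i * e i x := by
    funext x
    simp
  have hmem : ∀ (ρ : Measure E) [IsGaussian ρ] (i : ι), MemLp (fun x => c i * e i x) 2 ρ :=
    fun ρ _ i => (IsGaussian.memLp_dual ρ (e i) 2 (by simp)).const_mul (c i)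
  have h1 : ∀ (ρ : Measure E) [IsGaussian ρ],
      ∫ x, (∑ i, c i • e i) x ∂ρ = ∑ i, c i * ∫ x, e i x ∂ρ := fun ρ _ => by
    rw [hL, integral_finsetSum _ fun i _ => (hmem ρ i).integrable (by simp)]
    simp_rw [integral_const_mul]
  have h2 : ∀ (ρ : Measure E) [IsGaussian ρ],
      Var[⇑(∑ i, c i • e i); ρ] = ∑ i, ∑ j, c i * (c j * cov[e i, e j; ρ]) := fun ρ _ => by
    rw [← covariance_self (by fun_prop), hL, covariance_fun_sum_fun_sum (hmem ρ) (hmem ρ)]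
    simp_rw [covariance_const_mul_left, covariance_const_mul_right]
  rw [IsGaussian.charFunDual_eq, IsGaussian.charFunDual_eq, integral_complex_ofReal,
    integral_complex_ofReal, h1, h1, h2, h2]
  simp_rw [hm, hc]

theorem StrongDual.exists_eq_sum_proj {ι : Type*} [Fintype ι] {κ : ι → Type*}
    [∀ i, Fintype (κ i)] (L : StrongDual ℝ ((i : ι) → κ i → ℝ)) :
    ∃ c : (Σ i, κ i) → ℝ, L = ∑ x : Σ i, κ i, c x •
      (ContinuousLinearMap.proj x.2 ∘L ContinuousLinearMap.proj x.1 :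
        StrongDual ℝ ((i : ι) → κ i → ℝ)) := by
  classical
  refine ⟨fun x => L (Pi.single x.1 (Pi.single x.2 1)), ?_⟩
  ext z
  have hz : z = ∑ x : Σ i, κ i, z x.1 x.2 • Pi.single x.1 (Pi.single x.2 1) := by
    funext i q
    rw [Fintype.sum_sigma, Finset.sum_apply, Finset.sum_apply, Finset.sum_eq_single i,
      Finset.sum_apply, Finset.sum_apply, Finset.sum_eq_single q]
    · simp
    · intro p _ hp
      simp [hp.symm]
    · simp
    · intro k _ hk
      simp [Finset.sum_apply, hk.symm]
    · simp
  conv_lhs => rw [hz]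
  simp [mul_comm]

/-- By independence `(X, R)` has a product law, so the law of `(X, f X + R)` disintegrates over that
of `X` with kernel `x ↦ law of f x + R`. Conditional distributions are almost everywhere unique. -/
theorem ProbabilityTheory.condDistrib_of_indepFun_add {β E : Type*} [MeasurableSpace β]
    [AddCommMonoid E] [MeasurableSpace E] [MeasurableAdd₂ E] [StandardBorelSpace E] [Nonempty E]
    [IsProbabilityMeasure P] {X : Ω → β} {R : Ω → E} (hX : Measurable X) (hR : Measurable R)
    (h : IndepFun X R P) {f : β → E} (hf : Measurable f) :
    ∀ᵐ x ∂(P.map X), condDistrib (fun ω => f (X ω) + R ω) X P x =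
      P.map fun ω => f x + R ω := by
  have hprob : IsProbabilityMeasure (P.map R) := Measure.isProbabilityMeasure_map hR.aemeasurable
  have hprob : IsProbabilityMeasure (P.map X) := Measure.isProbabilityMeasure_map hX.aemeasurable
  have hg : Measurable fun p : β × E => f p.1 + p.2 := by fun_prop
  let κ : Kernel β E := (Kernel.id ×ₖ Kernel.const β (P.map R)).map fun p : β × E => f p.1 + p.2
  have hκ : ∀ x, κ x = P.map fun ω => f x + R ω := by
    intro x
    rw [Kernel.map_apply _ hg, Kernel.prod_apply, Kernel.id_apply, Kernel.const_apply,
      Measure.dirac_prod, Measure.map_map hg (by fun_prop), Measure.map_map (by fun_prop) hR]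
    rfl
  have hm : P.map (fun ω => (X ω, f (X ω) + R ω)) = P.map X ⊗ₘ κ := by
    have h' := (indepFun_iff_map_prod_eq_prod_map_map hX.aemeasurable hR.aemeasurable).1 h
    have : P.map (fun ω => (X ω, f (X ω) + R ω)) =
        ((P.map X).prod (P.map R)).map fun p => (p.1, f p.1 + p.2) := by
      rw [← h', Measure.map_map (by fun_prop) (by fun_prop)]
      rfl
    rw [this]
    ext s hs
    rw [Measure.map_apply (by fun_prop) hs, Measure.prod_apply (hs.preimage (by fun_prop)),
      Measure.compProd_apply hs]
    refine lintegral_congr fun x => ?_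
    rw [hκ, ← Function.comp_def (fun z => f x + z), ← Measure.map_map (by fun_prop) hR,
      Measure.map_apply (by fun_prop) (hs.preimage (by fun_prop))]
    rfl
  filter_upwards [condDistrib_ae_eq_of_measure_eq_compProd X (by fun_prop) hm] with x hx
  rw [hx, hκ]

theorem ProbabilityTheory.IsGaussianProcess.hasGaussianLaw_pi_pi {T : Type*} {Y : T → Ω → ℝ}
    (hY : IsGaussianProcess Y P) {ι : Type*} [Fintype ι] {κ : ι → Type*} [∀ i, Fintype (κ i)]
    (p : (i : ι) → κ i → T) : HasGaussianLaw (fun ω i q => Y (p i q) ω) P := by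
  classical
  let I : Finset T := Finset.univ.image fun x : Σ i, κ i => p x.1 x.2
  have hI : ∀ i q, p i q ∈ I := fun i q =>
    Finset.mem_image_of_mem (fun x : Σ i, κ i => p x.1 x.2) (Finset.mem_univ ⟨i, q⟩)
  exact (hY.hasGaussianLaw I).map (ContinuousLinearMap.pi fun i => ContinuousLinearMap.pi fun q =>
    ContinuousLinearMap.proj (⟨p i q, hI i q⟩ : I))

/-- Conditional distribution of finitely many values of a centered Gaussian process given
finitely many others: the law of the kriging predictor plus the prediction error. -/
theorem ProbabilityTheory.IsGaussianProcess.condDistrib_eq {D : Type*} [DecidableEq D]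
    {Y : D → Ω → ℝ} (hY : IsGaussianProcess Y P) (hmeas : ∀ s, Measurable (Y s))
    {S : Finset D} [IsProbabilityMeasure P] {G : Matrix S S ℝ} (hG : IsUnit G.det)
    (hGs : Gᵀ = G)
    (hcov : ∀ s t : S, cov[Y s, Y t; P] = G s t) {ι : Type*} [Fintype ι] {κ : ι → Type*}
    [∀ i, Fintype (κ i)] (p : (i : ι) → κ i → D) :
    ∀ᵐ x ∂(P.map fun ω (s : S) => Y s ω),
      condDistrib (fun ω i (q : κ i) => Y (p i q) ω) (fun ω (s : S) => Y s ω) P x =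
        P.map fun ω i q => (fun t : S => cov[Y (p i q), Y t; P]) ⬝ᵥ G⁻¹ *ᵥ x +
          (Y (p i q) ω -
            (fun t : S => cov[Y (p i q), Y t; P]) ⬝ᵥ G⁻¹ *ᵥ fun t : S => Y t ω) := by
  let R : D → Ω → ℝ := fun s ω =>
    Y s ω - (fun t : S => cov[Y s, Y t; P]) ⬝ᵥ G⁻¹ *ᵥ fun t : S => Y t ω
  have hRm : ∀ s, Measurable (R s) := fun s => by
    simp only [R, dotProduct, mulVec]
    fun_prop
  have hY2 : ∀ s, MemLp (Y s) 2 P := fun s => (hY.hasGaussianLaw_eval s).memLp_two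
  have hR : ∀ s, R s = fun ω => Y s ω -
      ∑ t : S, ((fun t : S => cov[Y s, Y t; P]) ᵥ* G⁻¹) t * Y t ω := fun s => by
    funext ω
    simp only [R]
    rw [dotProduct_mulVec]
    rfl
  -- Data and prediction errors form one Gaussian process, so that vanishing covariances imply
  -- independence.
  have hproc : IsGaussianProcess (Sum.elim (fun s : S => Y s) R) P := by
    refine hY.of_isGaussianProcess fun u => ?_
    match u with
    | Sum.inl s => exact ⟨{(s : D)}, ContinuousLinearMap.proj ⟨s, by simp⟩, fun ω => rfl⟩
    | Sum.inr s =>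
      refine ⟨insert s S, ContinuousLinearMap.proj ⟨s, by simp⟩ -
        ∑ t : S, ((fun t : S => cov[Y s, Y t; P]) ᵥ* G⁻¹) t •
          ContinuousLinearMap.proj ⟨(t : D), by simp⟩, fun ω => ?_⟩
      simp [hR]
  have hindep : IndepFun (fun ω (s : S) => Y s ω) (fun ω s => R s ω) P := by
    refine hproc.indepFun_of_covariance_eq_zero (fun s => (hmeas s).aemeasurable)
      (fun s => (hRm s).aemeasurable) fun s t => ?_
    rw [hR, covariance_fun_sub_right (Z := fun ω => ∑ u : S,
      ((fun t' : S => cov[Y t, Y t'; P]) ᵥ* G⁻¹) u * Y u ω) (hY2 s) (hY2 t)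
      (memLp_finsetSum _ fun (u : S) _ => (hY2 u).const_mul _),
      covariance_fun_sum_right (fun u : S => (hY2 u).const_mul _) (hY2 s)]
    simp_rw [covariance_const_mul_right, hcov]
    -- The normal equations: the kriging weights times `G` give back the covariances with the data,
    -- so error and data are uncorrelated.
    have h1 : ∑ u, ((fun t' : S => cov[Y t, Y t'; P]) ᵥ* G⁻¹) u * G s u =
        (((fun t' : S => cov[Y t, Y t'; P]) ᵥ* G⁻¹) ᵥ* Gᵀ) s := rfl
    rw [h1, hGs, vecMul_vecMul, nonsing_inv_mul _ hG, vecMul_one, covariance_comm, sub_self]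
  have hind' : IndepFun (fun ω (s : S) => Y s ω) (fun ω i q => R (p i q) ω) P :=
    hindep.comp measurable_id (by fun_prop : Measurable fun (r : D → ℝ) i (q : κ i) => r (p i q))
  have h := condDistrib_of_indepFun_add (by fun_prop) (by fun_prop) hind'
    (f := fun x i q => (fun t : S => cov[Y (p i q), Y t; P]) ⬝ᵥ G⁻¹ *ᵥ x) (by
      simp only [dotProduct, mulVec]
      fun_prop)
  have hsplit : (fun ω i (q : κ i) => Y (p i q) ω) = fun ω =>
      (fun i (q : κ i) => (fun t : S => cov[Y (p i q), Y t; P]) ⬝ᵥ G⁻¹ *ᵥ fun s : S => Y s ω) +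
        fun i q => R (p i q) ω := by
    funext ω i q
    simp [R]
  rw [hsplit]
  exact h

end GaussianLemmas

/-! ### Linear Gaussian models, for the prior as well as the posterior weights. -/

section Models

open Matrix

variable {Ω : Type*} {T ι : Type*} {κ : ι → Type*} [Fintype ι]
  [∀ a, Fintype (κ a)]

/-- A linear combination of the components of weight vectors. -/
noncomputable def weightSum (η : (a : ι) → Ω → EuclideanSpace ℝ (κ a)) (β : (a : ι) → κ a → ℝ)
    (ω : Ω) : ℝ := ∑ a, β a ⬝ᵥ (η a ω).ofLp

theorem weightSum_add (η : (a : ι) → Ω → EuclideanSpace ℝ (κ a)) (β γ : (a : ι) → κ a → ℝ)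
    (ω : Ω) : weightSum η (β + γ) ω = weightSum η β ω + weightSum η γ ω := by
  simp [weightSum, add_dotProduct, Finset.sum_add_distrib]

variable [MeasurableSpace Ω] [∀ a, DecidableEq (κ a)]

/-- Independent Gaussian weight vectors, and a Gaussian process that is independent of them. -/
structure IsGaussianModel (P : Measure Ω) (η : (a : ι) → Ω → EuclideanSpace ℝ (κ a))
    (m : (a : ι) → κ a → ℝ) (K : (a : ι) → Matrix (κ a) (κ a) ℝ) (δ : T → Ω → ℝ) : Prop where
  posSemidef : ∀ a, (K a).PosSemidef
  measurable_weight : ∀ a, Measurable (η a)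
  law_weight : ∀ a, P.map (η a) = multivariateGaussian (WithLp.toLp 2 (m a)) (K a)
  measurable_process : ∀ s, Measurable (δ s)
  gaussian_process : IsGaussianProcess δ P
  indep_weights : iIndepFun η P
  indep_process : IndepFun (fun ω a => η a ω) (fun ω s => δ s ω) P

namespace IsGaussianModel

variable {P : Measure Ω} {η : (a : ι) → Ω → EuclideanSpace ℝ (κ a)} {m : (a : ι) → κ a → ℝ}
  {K : (a : ι) → Matrix (κ a) (κ a) ℝ} {δ : T → Ω → ℝ}

omit [Fintype ι] in
theorem hasGaussianLaw_weight (h : IsGaussianModel P η m K δ) (a : ι) :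
    HasGaussianLaw (η a) P where
  isGaussian_map := by
    rw [h.law_weight]
    infer_instance

/-- Independence makes the weight vectors jointly Gaussian, and then jointly Gaussian with any
finite part of `δ`; coordinates are continuous linear images of these. -/
theorem isGaussianProcess_latent (h : IsGaussianModel P η m K δ) :
    IsGaussianProcess (Sum.elim (fun (x : Σ a, κ a) ω => (η x.1 ω).ofLp x.2) δ) P where
  hasGaussianLaw I := by
    classical
    let F : Finset T := I.toRight
    have h1 : HasGaussianLaw (fun ω a => η a ω) P :=
      h.indep_weights.hasGaussianLaw h.hasGaussianLaw_weight
    have h2 : IndepFun (fun ω a => η a ω) (fun ω => F.restrict (δ · ω)) P :=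
      h.indep_process.comp measurable_id (Finset.measurable_restrict F)
    -- The value `0` off `F` only makes `c` total; no index in `I` reaches it.
    let c : (Σ a, κ a) ⊕ T → StrongDual ℝ (((a : ι) → EuclideanSpace ℝ (κ a)) × (F → ℝ)) :=
      Sum.elim (fun x => EuclideanSpace.proj x.2 ∘L ContinuousLinearMap.proj x.1 ∘L
          ContinuousLinearMap.fst ℝ _ _)
        fun t => if ht : t ∈ F then ContinuousLinearMap.proj (⟨t, ht⟩ : F) ∘L
          ContinuousLinearMap.snd ℝ _ _ else 0
    have h3 := (h2.hasGaussianLaw h1 (h.gaussian_process.hasGaussianLaw F)).map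
      (ContinuousLinearMap.pi fun i : I => c i)
    convert! h3 using 1
    funext ω ⟨i, hi⟩
    rcases i with x | t
    · rfl
    · have ht : t ∈ F := Finset.mem_toRight.2 hi
      simp [c, ht]

theorem isGaussianProcess_of_eq (h : IsGaussianModel P η m K δ) {U : Type*} {Y : U → Ω → ℝ}
    (hY : ∀ u, ∃ (β : (a : ι) → κ a → ℝ) (F : Finset T) (c : T → ℝ),
      ∀ ω, Y u ω = weightSum η β ω + ∑ t ∈ F, c t * δ t ω) : IsGaussianProcess Y P := by
  classical
  have hlatent := h.isGaussianProcess_latent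
  refine hlatent.of_isGaussianProcess fun u => ?_
  obtain ⟨β, F, c, hu⟩ := hY u
  refine ⟨(Finset.univ : Finset (Σ a, κ a)).disjSum F,
    ∑ x : Σ a, κ a, β x.1 x.2 • ContinuousLinearMap.proj ⟨Sum.inl x, by simp⟩ +
      ∑ t : F, c t • ContinuousLinearMap.proj ⟨Sum.inr (t : T), by simp⟩, fun ω => ?_⟩
  rw [hu, weightSum, ← Finset.sum_coe_sort F]
  simp [Fintype.sum_sigma, dotProduct]

theorem isGaussianProcess_response (h : IsGaussianModel P η m K δ)
    (β : T → (a : ι) → κ a → ℝ) :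
    IsGaussianProcess (fun t ω => weightSum η (β t) ω + δ t ω) P :=
  h.isGaussianProcess_of_eq fun t => ⟨β t, {t}, 1, fun ω => by simp⟩

omit [Fintype ι] in
theorem memLp_dotProduct (h : IsGaussianModel P η m K δ) {a : ι} (c : κ a → ℝ) :
    MemLp (fun ω => c ⬝ᵥ (η a ω).ofLp) 2 P := by
  have := ((h.hasGaussianLaw_weight a).map (innerSL ℝ (WithLp.toLp 2 c))).memLp_two
  convert! this using 2 with ω
  simp [EuclideanSpace.inner_eq_star_dotProduct, dotProduct_comm]

omit [Fintype ι] in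
theorem memLp_process (h : IsGaussianModel P η m K δ) (t : T) : MemLp (δ t) 2 P :=
  (h.gaussian_process.hasGaussianLaw_eval t).memLp_two

theorem memLp_weightSum (h : IsGaussianModel P η m K δ) (β : (a : ι) → κ a → ℝ) :
    MemLp (weightSum η β) 2 P :=
  memLp_finsetSum _ fun _ _ => h.memLp_dotProduct _

omit [Fintype ι] in
theorem integral_dotProduct (h : IsGaussianModel P η m K δ) {a : ι} (c : κ a → ℝ) :
    ∫ ω, c ⬝ᵥ (η a ω).ofLp ∂P = c ⬝ᵥ m a := by
  have h1 : ∫ ω, innerSL ℝ (WithLp.toLp 2 c) (η a ω) ∂P =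
      innerSL ℝ (WithLp.toLp 2 c) (∫ ω, η a ω ∂P) :=
    ContinuousLinearMap.integral_comp_comm _ (h.hasGaussianLaw_weight a).integrable
  have h2 : ∫ ω, η a ω ∂P = WithLp.toLp 2 (m a) := by
    rw [← integral_id_multivariateGaussian (μ := WithLp.toLp 2 (m a)) (S := K a),
      ← h.law_weight a, integral_map (h.measurable_weight a).aemeasurable (by fun_prop)]
  rw [h2] at h1
  simpa [EuclideanSpace.inner_eq_star_dotProduct, dotProduct_comm] using h1

theorem integral_weightSum (h : IsGaussianModel P η m K δ) (β : (a : ι) → κ a → ℝ)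
    [IsProbabilityMeasure P] :
    ∫ ω, weightSum η β ω ∂P = ∑ a, β a ⬝ᵥ m a := by
  simp only [weightSum]
  rw [integral_finsetSum _ fun a _ => (h.memLp_dotProduct (β a)).integrable (by simp)]
  simp_rw [h.integral_dotProduct]

omit [Fintype ι] in
theorem covariance_dotProduct (h : IsGaussianModel P η m K δ) {a : ι} (c d : κ a → ℝ) :
    cov[fun ω => c ⬝ᵥ (η a ω).ofLp, fun ω => d ⬝ᵥ (η a ω).ofLp; P] = c ⬝ᵥ K a *ᵥ d := by
  have h1 := covarianceBilin_multivariateGaussian (μ := WithLp.toLp 2 (m a)) (h.posSemidef a)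
    (WithLp.toLp 2 c) (WithLp.toLp 2 d)
  rw [covarianceBilin_apply_eq_cov IsGaussian.memLp_two_id, ← h.law_weight a,
    covariance_map_fun (by fun_prop) (by fun_prop) (h.measurable_weight a).aemeasurable] at h1
  simpa [EuclideanSpace.inner_eq_star_dotProduct, dotProduct_comm] using h1

theorem covariance_weightSum (h : IsGaussianModel P η m K δ) [IsProbabilityMeasure P]
    (β γ : (a : ι) → κ a → ℝ) :
    cov[weightSum η β, weightSum η γ; P] = ∑ a, β a ⬝ᵥ K a *ᵥ γ a := by
  classical
  have h1 := covariance_fun_sum_fun_sum (μ := P) (fun a => h.memLp_dotProduct (β a))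
    (fun a => h.memLp_dotProduct (γ a))
  refine h1.trans (Finset.sum_congr rfl fun a _ => ?_)
  -- The cross terms vanish by independence of distinct weight vectors.
  rw [Finset.sum_eq_single a _ (by simp), h.covariance_dotProduct]
  intro a' _ ha
  exact ((h.indep_weights.indepFun ha.symm).comp
    (φ := fun x : EuclideanSpace ℝ (κ a) => β a ⬝ᵥ x.ofLp)
    (ψ := fun x : EuclideanSpace ℝ (κ a') => γ a' ⬝ᵥ x.ofLp)
    (by simp only [dotProduct]; fun_prop) (by simp only [dotProduct]; fun_prop)).covariance_eq_zero
    (h.memLp_dotProduct _) (h.memLp_dotProduct _)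

theorem covariance_weightSum_process (h : IsGaussianModel P η m K δ) [IsProbabilityMeasure P]
    (β : (a : ι) → κ a → ℝ) (t : T) : cov[weightSum η β, δ t; P] = 0 := by
  have h1 : Measurable fun x : (a : ι) → EuclideanSpace ℝ (κ a) => ∑ a, β a ⬝ᵥ (x a).ofLp := by
    simp only [dotProduct]
    fun_prop
  have h2 : IndepFun (weightSum η β) (δ t) P := h.indep_process.comp h1 (measurable_pi_apply t)
  exact h2.covariance_eq_zero (h.memLp_weightSum β) (h.memLp_process t)

theorem covariance_weightSum_response (h : IsGaussianModel P η m K δ) [IsProbabilityMeasure P]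
    (β γ : (a : ι) → κ a → ℝ) (t : T) :
    cov[weightSum η β, fun ω => weightSum η γ ω + δ t ω; P] = ∑ a, β a ⬝ᵥ K a *ᵥ γ a := by
  have := covariance_add_right (h.memLp_weightSum β) (h.memLp_weightSum γ) (h.memLp_process t)
  rw [h.covariance_weightSum, h.covariance_weightSum_process, add_zero] at this
  exact this

theorem covariance_response (h : IsGaussianModel P η m K δ) [IsProbabilityMeasure P]
    (β γ : (a : ι) → κ a → ℝ) (s t : T) :
    cov[fun ω => weightSum η β ω + δ s ω, fun ω => weightSum η γ ω + δ t ω; P] =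
      (∑ a, β a ⬝ᵥ K a *ᵥ γ a) + cov[δ s, δ t; P] := by
  have h1 := covariance_add_left (h.memLp_weightSum β) (h.memLp_process s)
    ((h.memLp_weightSum γ).add (h.memLp_process t))
  have h2 := covariance_add_right (h.memLp_process s) (h.memLp_weightSum γ) (h.memLp_process t)
  have h3 := h.covariance_weightSum_response β γ t
  rw [h2, covariance_comm (δ s), h.covariance_weightSum_process, zero_add] at h1
  exact h1.trans (by rw [← h3]; rfl)

theorem integral_response (h : IsGaussianModel P η m K δ) [IsProbabilityMeasure P]
    (β : (a : ι) → κ a → ℝ) (t : T) :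
    ∫ ω, (weightSum η β ω + δ t ω) ∂P = (∑ a, β a ⬝ᵥ m a) + ∫ ω, δ t ω ∂P := by
  rw [integral_add ((h.memLp_weightSum β).integrable (by simp))
    ((h.memLp_process t).integrable (by simp)), h.integral_weightSum]

theorem measurable_weightSum (h : IsGaussianModel P η m K δ) (β : (a : ι) → κ a → ℝ) :
    Measurable (weightSum η β) := by
  have := h.measurable_weight
  unfold weightSum dotProduct
  fun_prop

end IsGaussianModel

/-- Coordinates are independent exactly when their joint law is the product of the marginals; here
`f` is used for the two projections of a product measure. -/
theorem ProbabilityTheory.iIndepFun_comp_measurePreserving {Ω' : Type*} [MeasurableSpace Ω']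
    {E : ι → Type*} [∀ a, MeasurableSpace (E a)] {μ : (a : ι) → Measure (E a)}
    [∀ a, IsProbabilityMeasure (μ a)] {P : Measure Ω'} [IsProbabilityMeasure P]
    {f : Ω' → (a : ι) → E a} (hf : MeasurePreserving f P (Measure.pi μ)) :
    iIndepFun (fun a ω => f ω a) P := by
  have := hf.measurable
  rw [iIndepFun_iff_map_fun_eq_pi_map (by fun_prop)]
  have h1 : ∀ a, P.map (fun ω => f ω a) = μ a := fun a =>
    ((measurePreserving_eval μ a).comp hf).map_eq
  simp_rw [h1]
  exact hf.map_eq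

section Product

variable {ι' : Type*} [Fintype ι'] {κ' : ι' → Type*} [∀ j, Fintype (κ' j)]
  [∀ j, DecidableEq (κ' j)] {m : (a : ι) → κ a → ℝ} {K : (a : ι) → Matrix (κ a) (κ a) ℝ}
  {m' : (j : ι') → κ' j → ℝ} {K' : (j : ι') → Matrix (κ' j) (κ' j) ℝ}

/-- The joint law of independent Gaussian vectors. -/
noncomputable abbrev prodGaussian (m : (a : ι) → κ a → ℝ) (K : (a : ι) → Matrix (κ a) (κ a) ℝ)
    (m' : (j : ι') → κ' j → ℝ) (K' : (j : ι') → Matrix (κ' j) (κ' j) ℝ) :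
    Measure (((a : ι) → EuclideanSpace ℝ (κ a)) × ((j : ι') → EuclideanSpace ℝ (κ' j))) :=
  (Measure.pi fun a => multivariateGaussian (WithLp.toLp 2 (m a)) (K a)).prod
    (Measure.pi fun j => multivariateGaussian (WithLp.toLp 2 (m' j)) (K' j))

theorem iIndepFun_snd_prodGaussian :
    iIndepFun (fun j (z : ((a : ι) → EuclideanSpace ℝ (κ a)) ×
      ((j : ι') → EuclideanSpace ℝ (κ' j))) => z.2 j) (prodGaussian m K m' K') :=
  iIndepFun_comp_measurePreserving measurePreserving_snd

theorem map_snd_prodGaussian (j : ι') :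
    (prodGaussian m K m' K').map (fun z => z.2 j) =
      multivariateGaussian (WithLp.toLp 2 (m' j)) (K' j) :=
  ((measurePreserving_eval (fun j => multivariateGaussian (WithLp.toLp 2 (m' j)) (K' j)) j).comp
    measurePreserving_snd).map_eq

/-- The coordinates of the second factor play the role of the process `δ`, so the moment formulas
for responses apply to the posterior components too. -/
theorem isGaussianModel_prodGaussian (hK : ∀ a, (K a).PosSemidef) :
    IsGaussianModel (prodGaussian m K m' K') (fun a z => z.1 a) m K
      fun (x : Σ j, κ' j) z => (z.2 x.1).ofLp x.2 where
  posSemidef := hK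
  measurable_weight a := by fun_prop
  law_weight a := ((measurePreserving_eval
    (fun a => multivariateGaussian (WithLp.toLp 2 (m a)) (K a)) a).comp
      measurePreserving_fst).map_eq
  measurable_process s := by fun_prop
  gaussian_process := by
    have h1 : HasGaussianLaw (fun z j => z.2 j) (prodGaussian m K m' K') := by
      refine iIndepFun_snd_prodGaussian.hasGaussianLaw fun j => ⟨?_⟩
      rw [map_snd_prodGaussian]
      infer_instance
    exact ⟨fun I => h1.map (ContinuousLinearMap.pi fun x : I =>
      (EuclideanSpace.proj x.1.2 : StrongDual ℝ (EuclideanSpace ℝ (κ' x.1.1))) ∘L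
        (ContinuousLinearMap.proj x.1.1 :
          ((j : ι') → EuclideanSpace ℝ (κ' j)) →L[ℝ] EuclideanSpace ℝ (κ' x.1.1)))⟩
  indep_weights := iIndepFun_comp_measurePreserving measurePreserving_fst
  indep_process := by
    have h1 := indepFun_prod
      (μ := Measure.pi fun a => multivariateGaussian (WithLp.toLp 2 (m a)) (K a))
      (ν := Measure.pi fun j => multivariateGaussian (WithLp.toLp 2 (m' j)) (K' j))
      measurable_id measurable_id
    exact h1.comp (φ := id) (ψ := fun z (x : Σ j, κ' j) => (z x.1).ofLp x.2)
      measurable_id (by fun_prop)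

theorem integral_snd_prodGaussian (j : ι') (q : κ' j) :
    ∫ z, (z.2 j).ofLp q ∂(prodGaussian m K m' K') = m' j q := by
  have h1 : ∫ x, x.ofLp q ∂(multivariateGaussian (WithLp.toLp 2 (m' j)) (K' j)) = m' j q := by
    have := ContinuousLinearMap.integral_comp_comm (EuclideanSpace.proj (𝕜 := ℝ) q)
      (IsGaussian.integrable_id (μ := multivariateGaussian (WithLp.toLp 2 (m' j)) (K' j)))
    simpa using this
  rw [← h1, ← map_snd_prodGaussian (m := m) (K := K) (m' := m') (K' := K') j,
    integral_map (by fun_prop) (by fun_prop)]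

theorem covariance_snd_prodGaussian (hK' : ∀ j, (K' j).PosSemidef) (j : ι') (p q : κ' j) :
    cov[fun z => (z.2 j).ofLp p, fun z => (z.2 j).ofLp q; prodGaussian m K m' K'] = K' j p q := by
  rw [← covariance_eval_multivariateGaussian (μ := WithLp.toLp 2 (m' j)) (hK' j) p q,
    ← map_snd_prodGaussian (m := m) (K := K) (m' := m') (K' := K') j,
    covariance_map_fun (by fun_prop) (by fun_prop) (by fun_prop)]

theorem covariance_snd_prodGaussian_of_ne {j j' : ι'} (hj : j ≠ j') (p : κ' j) (q : κ' j') :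
    cov[fun z => (z.2 j).ofLp p, fun z => (z.2 j').ofLp q; prodGaussian m K m' K'] = 0 := by
  have hmem : ∀ (j : ι') (p : κ' j), MemLp (fun z : ((a : ι) → EuclideanSpace ℝ (κ a)) ×
      ((j : ι') → EuclideanSpace ℝ (κ' j)) => (z.2 j).ofLp p) 2 (prodGaussian m K m' K') := by
    intro j p
    have h1 : HasGaussianLaw (fun z => z.2 j) (prodGaussian m K m' K') := ⟨by
      rw [map_snd_prodGaussian]
      infer_instance⟩
    exact (h1.map (EuclideanSpace.proj p)).memLp_two
  exact ((iIndepFun_snd_prodGaussian.indepFun hj).comp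
    (φ := fun x : EuclideanSpace ℝ (κ' j) => x.ofLp p)
    (ψ := fun x : EuclideanSpace ℝ (κ' j') => x.ofLp q)
    (by fun_prop) (by fun_prop)).covariance_eq_zero (hmem j p) (hmem j' q)

end Product

end Models

/-! ### The multi-resolution process: conditional covariances and posterior law. -/

namespace MRA

open Matrix

variable {D : Type*} [DecidableEq D] {J M : ℕ} (X : MRA D J M)
  {Ω : Type*} {η : (m : Fin M) → (j : Fin m → Fin J) → Ω → EuclideanSpace ℝ (X.knots m j)}
  {δ : D → Ω → ℝ}

theorem y_eq_weightSum (s : D) : X.y η δ s = fun ω =>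
    weightSum (fun a : (m : Fin M) × (Fin m → Fin J) => η a.1 a.2) (fun a => X.b a.1 a.2 s) ω +
      δ s ω := by
  funext ω
  rw [y, weightSum, Fintype.sum_sigma]

/-- The basis functions of the levels from `l` on. -/
noncomputable def basisFrom (l : ℕ) (s : D) (a : (m : Fin M) × (Fin m → Fin J)) :
    X.knots a.1 a.2 → ℝ := if l ≤ a.1 then X.b a.1 a.2 s else 0

/-- The basis functions of the levels below `l`. -/
noncomputable def basisBelow (l : ℕ) (s : D) (a : (m : Fin M) × (Fin m → Fin J)) :
    X.knots a.1 a.2 → ℝ := if l ≤ a.1 then 0 else X.b a.1 a.2 s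

theorem basisBelow_add_basisFrom (l : ℕ) (s : D) :
    X.basisBelow l s + X.basisFrom l s =
      fun a : (m : Fin M) × (Fin m → Fin J) => X.b a.1 a.2 s := by
  funext a
  by_cases h : l ≤ a.1 <;> simp [basisBelow, basisFrom, h]

theorem basisFrom_zero (s : D) : X.basisFrom 0 s =
      fun a : (m : Fin M) × (Fin m → Fin J) => X.b a.1 a.2 s := by
  funext a
  simp [basisFrom]

theorem sum_basisFrom (l : ℕ) (s t : D) :
    (∑ a : (m : Fin M) × (Fin m → Fin J),
      X.basisFrom l s a ⬝ᵥ X.K a.1 a.2 *ᵥ X.basisFrom l t a) + X.v M s t = X.covGiven l s t := by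
  rw [covGiven, Fintype.sum_sigma]
  congr 1
  have h1 : ∀ m : Fin M, (∑ j : Fin m → Fin J,
      X.basisFrom l s ⟨m, j⟩ ⬝ᵥ X.K m j *ᵥ X.basisFrom l t ⟨m, j⟩) =
      if l ≤ (m : ℕ) then ∑ j : Fin m → Fin J, X.b m j s ⬝ᵥ X.K m j *ᵥ X.b m j t else 0 := by
    intro m
    by_cases h : l ≤ (m : ℕ) <;> simp [basisFrom, h]
  simp_rw [h1]
  rw [Fin.sum_univ_eq_sum_range (fun m => if l ≤ m then ∑ j : Fin m → Fin J,
    X.b m j s ⬝ᵥ X.K m j *ᵥ X.b m j t else 0), ← Finset.sum_filter]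
  congr 1
  ext m
  simp [and_comm]

theorem measurable_weightSigma_basisBelow (l : ℕ) (s : D) :
    Measurable[X.weightSigma η l]
      (weightSum (fun a : (m : Fin M) × (Fin m → Fin J) => η a.1 a.2) (X.basisBelow l s)) := by
  unfold weightSum
  refine Finset.measurable_fun_sum _ fun a _ => ?_
  by_cases ha : l ≤ a.1
  · simp [basisBelow, ha]
  · have hle : MeasurableSpace.comap (η a.1 a.2) inferInstance ≤ X.weightSigma η l :=
      le_iSup_of_le a.1 (le_iSup_of_le (not_le.1 ha) (le_iSup_of_le a.2 le_rfl))
    have h1 : Measurable[X.weightSigma η l] (η a.1 a.2) :=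
      (comap_measurable (η a.1 a.2)).mono hle le_rfl
    have h2 : Measurable fun x : EuclideanSpace ℝ (X.knots a.1 a.2) =>
        X.basisBelow l s a ⬝ᵥ x.ofLp := by
      simp only [dotProduct]
      fun_prop
    exact h2.comp h1

variable [MeasurableSpace Ω] {P : Measure Ω}

theorem IsPrior.isGaussianModel {X : MRA D J M}
    {η : (m : Fin M) → (j : Fin m → Fin J) → Ω → EuclideanSpace ℝ (X.knots m j)} {δ : D → Ω → ℝ}
    (h : X.IsPrior P η δ)
    (hK : ∀ m < M, ∀ j : Fin m → Fin J, IsUnit (X.Kinv m j)) :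
    IsGaussianModel P (fun a : (m : Fin M) × (Fin m → Fin J) => η a.1 a.2) 0
      (fun a => X.K a.1 a.2) δ where
  posSemidef a := (X.posDef_K hK a.1.2 a.2).posSemidef
  measurable_weight a := h.measurable_weight a.1 a.2
  law_weight a := h.law_weight a.1 a.2
  measurable_process := h.measurable_remainder
  gaussian_process := h.gaussian_remainder
  indep_weights := h.indep_weights
  indep_process := h.indep_remainder

theorem covariance_residual (h : X.IsPrior P η δ) [IsProbabilityMeasure P]
    (hK : ∀ m < M, ∀ j : Fin m → Fin J, IsUnit (X.Kinv m j)) (l : ℕ) (s t : D) :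
    cov[fun ω => weightSum (fun a : (m : Fin M) × (Fin m → Fin J) => η a.1 a.2)
        (X.basisFrom l s) ω + δ s ω,
      fun ω => weightSum (fun a : (m : Fin M) × (Fin m → Fin J) => η a.1 a.2)
        (X.basisFrom l t) ω + δ t ω; P] = X.covGiven l s t := by
  rw [(h.isGaussianModel hK).covariance_response, h.cov_remainder, sum_basisFrom]

theorem integral_residual (h : X.IsPrior P η δ) [IsProbabilityMeasure P]
    (hK : ∀ m < M, ∀ j : Fin m → Fin J, IsUnit (X.Kinv m j)) (l : ℕ) (s : D) :
    ∫ ω, (weightSum (fun a : (m : Fin M) × (Fin m → Fin J) => η a.1 a.2)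
        (X.basisFrom l s) ω + δ s ω) ∂P = 0 := by
  rw [(h.isGaussianModel hK).integral_response, h.mean_remainder]
  simp

theorem covariance_y (h : X.IsPrior P η δ) [IsProbabilityMeasure P]
    (hK : ∀ m < M, ∀ j : Fin m → Fin J, IsUnit (X.Kinv m j)) (s t : D) :
    cov[X.y η δ s, X.y η δ t; P] = X.covGiven 0 s t := by
  have := X.covariance_residual h hK 0 s t
  rwa [basisFrom_zero, basisFrom_zero, ← y_eq_weightSum, ← y_eq_weightSum] at this

theorem integral_y (h : X.IsPrior P η δ) [IsProbabilityMeasure P]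
    (hK : ∀ m < M, ∀ j : Fin m → Fin J, IsUnit (X.Kinv m j)) (s : D) :
    ∫ ω, X.y η δ s ω ∂P = 0 := by
  have := X.integral_residual h hK 0 s
  rw [basisFrom_zero] at this
  rwa [y_eq_weightSum]

theorem isGaussianProcess_y (h : X.IsPrior P η δ)
    (hK : ∀ m < M, ∀ j : Fin m → Fin J, IsUnit (X.Kinv m j)) :
    IsGaussianProcess (X.y η δ) P := by
  rw [funext fun s => X.y_eq_weightSum (η := η) (δ := δ) s]
  exact (h.isGaussianModel hK).isGaussianProcess_response fun s a => X.b a.1 a.2 s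

theorem measurable_y (h : X.IsPrior P η δ)
    (hK : ∀ m < M, ∀ j : Fin m → Fin J, IsUnit (X.Kinv m j)) (s : D) :
    Measurable (X.y η δ s) := by
  rw [y_eq_weightSum]
  exact ((h.isGaussianModel hK).measurable_weightSum _).add (h.measurable_remainder s)

theorem weightSigma_le (h : X.IsPrior P η δ) (l : ℕ) :
    X.weightSigma η l ≤ ‹MeasurableSpace Ω› :=
  iSup_le fun m => iSup_le fun _ => iSup_le fun j => (h.measurable_weight m j).comap_le

/-- The residual involves only weights of levels at least `l` and `δ`, so it is uncorrelated with
every coordinate of the earlier weights. Joint Gaussianity upgrades this to independence. -/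
theorem indep_weightSigma (h : X.IsPrior P η δ) [IsProbabilityMeasure P]
    (hK : ∀ m < M, ∀ j : Fin m → Fin J, IsUnit (X.Kinv m j)) (l : ℕ) :
    Indep (MeasurableSpace.comap (fun ω s =>
      weightSum (fun a : (m : Fin M) × (Fin m → Fin J) => η a.1 a.2) (X.basisFrom l s) ω + δ s ω)
        inferInstance) (X.weightSigma η l) P := by
  classical
  have hm := h.isGaussianModel hK
  -- `U` indexes the scalar coordinates of the weights below level `l`; `c u` is the unit vector
  -- that extracts the coordinate `u`.
  let U := Σ a : {a : (m : Fin M) × (Fin m → Fin J) // ¬ l ≤ a.1}, X.knots a.1.1 a.1.2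
  let c : U → (a : (m : Fin M) × (Fin m → Fin J)) → X.knots a.1 a.2 → ℝ :=
    fun u => Pi.single u.1.1 (Pi.single u.2 1)
  let W : U → Ω → ℝ := fun u =>
    weightSum (fun a : (m : Fin M) × (Fin m → Fin J) => η a.1 a.2) (c u)
  let Z : D → Ω → ℝ := fun s ω =>
    weightSum (fun a : (m : Fin M) × (Fin m → Fin J) => η a.1 a.2) (X.basisFrom l s) ω + δ s ω
  have hW : ∀ u ω, W u ω = (η u.1.1.1 u.1.1.2 ω).ofLp u.2 := by
    intro u ω
    simp only [W, weightSum, c]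
    rw [Finset.sum_eq_single u.1.1]
    · simp
    · intro a _ ha
      rw [Pi.single_eq_of_ne ha, zero_dotProduct]
    · simp
  have hproc : IsGaussianProcess (Sum.elim W Z) P := by
    refine hm.isGaussianProcess_of_eq fun u => ?_
    match u with
    | Sum.inl u => exact ⟨c u, ∅, 0, fun ω => by simp [W]⟩
    | Sum.inr s => exact ⟨X.basisFrom l s, {s}, 1, fun ω => by simp [Z]⟩
  have hind : IndepFun (fun ω u => W u ω) (fun ω s => Z s ω) P := by
    refine hproc.indepFun_of_covariance_eq_zero
      (fun u => (hm.measurable_weightSum _).aemeasurable)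
      (fun s => ((hm.measurable_weightSum _).add (h.measurable_remainder s)).aemeasurable)
      fun u s => ?_
    rw [hm.covariance_weightSum_response]
    refine Finset.sum_eq_zero fun a _ => ?_
    by_cases ha : a = u.1.1
    · subst ha
      rw [basisFrom, if_neg u.1.2, mulVec_zero, dotProduct_zero]
    · simp only [c]
      rw [Pi.single_eq_of_ne ha, zero_dotProduct]
  refine indep_of_indep_of_le_right hind.symm ?_
  refine iSup_le fun m => iSup_le fun hml => iSup_le fun j => ?_
  rw [← measurable_iff_comap_le]
  -- Each earlier weight vector is a measurable function of its coordinates, so `W` generates a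
  -- σ-algebra that contains `weightSigma`.
  have h1 : η m j = (fun w : U → ℝ =>
      WithLp.toLp 2 fun q => w ⟨⟨⟨m, j⟩, not_le.2 hml⟩, q⟩) ∘ fun ω u => W u ω := by
    funext ω
    ext q
    simp [hW]
  rw [h1]
  exact Measurable.comp (by fun_prop) (comap_measurable _)

/-- The part of the process below level `l` is measurable for the conditioning σ-algebra; the rest
is independent of it and centered. -/
theorem condExp_y (h : X.IsPrior P η δ) [IsProbabilityMeasure P]
    (hK : ∀ m < M, ∀ j : Fin m → Fin J, IsUnit (X.Kinv m j)) (l : ℕ) (s : D) :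
    X.y η δ s - P[X.y η δ s | X.weightSigma η l] =ᵐ[P] fun ω =>
      weightSum (fun a : (m : Fin M) × (Fin m → Fin J) => η a.1 a.2) (X.basisFrom l s) ω +
        δ s ω := by
  have hm := h.isGaussianModel hK
  set Z : D → Ω → ℝ := fun s ω =>
    weightSum (fun a : (m : Fin M) × (Fin m → Fin J) => η a.1 a.2) (X.basisFrom l s) ω + δ s ω
  set W : Ω → ℝ :=
    weightSum (fun a : (m : Fin M) × (Fin m → Fin J) => η a.1 a.2) (X.basisBelow l s)
  have hy : X.y η δ s = W + Z s := by
    funext ω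
    rw [y_eq_weightSum, ← X.basisBelow_add_basisFrom l]
    exact (congrArg (· + δ s ω) (weightSum_add _ _ _ ω)).trans (add_assoc _ _ _)
  have hWi : Integrable W P := (hm.memLp_weightSum _).integrable (by simp)
  have hZi : Integrable (Z s) P :=
    ((hm.memLp_weightSum _).add (hm.memLp_process s)).integrable (by simp)
  have hZm : Measurable fun ω s => Z s ω := measurable_pi_lambda _ fun s =>
    (hm.measurable_weightSum _).add (h.measurable_remainder s)
  have h1 : P[W | X.weightSigma η l] = W := condExp_of_stronglyMeasurable (X.weightSigma_le h l)
    (X.measurable_weightSigma_basisBelow l s).stronglyMeasurable hWi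
  have h2 : P[Z s | X.weightSigma η l] =ᵐ[P] fun _ => P[Z s] :=
    condExp_indep_eq hZm.comap_le (X.weightSigma_le h l)
      ((measurable_pi_apply s).comp (comap_measurable fun ω s => Z s ω)).stronglyMeasurable
      (X.indep_weightSigma h hK l)
  have h3 : P[Z s] = 0 := X.integral_residual h hK l s
  rw [hy]
  filter_upwards [condExp_add hWi hZi (X.weightSigma η l), h2] with ω h4 h5
  rw [Pi.sub_apply, h4, Pi.add_apply, Pi.add_apply, h1, h5, h3]
  ring

/-- The centered variables are residuals independent of the conditioning σ-algebra, so the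
conditional expectation of their product is its constant mean. -/
theorem condExp_mul_eq_covGiven (h : X.IsPrior P η δ) [IsProbabilityMeasure P]
    (hK : ∀ m < M, ∀ j : Fin m → Fin J, IsUnit (X.Kinv m j)) (l : ℕ) (s t : D) :
    P[(X.y η δ s - P[X.y η δ s | X.weightSigma η l]) *
        (X.y η δ t - P[X.y η δ t | X.weightSigma η l]) | X.weightSigma η l]
      =ᵐ[P] fun _ => X.covGiven l s t := by
  have hm := h.isGaussianModel hK
  set Z : D → Ω → ℝ := fun s ω =>
    weightSum (fun a : (m : Fin M) × (Fin m → Fin J) => η a.1 a.2) (X.basisFrom l s) ω + δ s ω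
  have hZm : Measurable fun ω s => Z s ω := measurable_pi_lambda _ fun s =>
    (hm.measurable_weightSum _).add (h.measurable_remainder s)
  have hZ2 : ∀ s, MemLp (Z s) 2 P := fun s => (hm.memLp_weightSum _).add (hm.memLp_process s)
  have h1 : P[(X.y η δ s - P[X.y η δ s | X.weightSigma η l]) *
        (X.y η δ t - P[X.y η δ t | X.weightSigma η l]) | X.weightSigma η l]
      =ᵐ[P] P[Z s * Z t | X.weightSigma η l] :=
    condExp_congr_ae ((X.condExp_y h hK l s).mul (X.condExp_y h hK l t))
  have h2 : P[Z s * Z t | X.weightSigma η l] =ᵐ[P] fun _ => P[Z s * Z t] :=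
    condExp_indep_eq hZm.comap_le (X.weightSigma_le h l)
      (((measurable_pi_apply s).comp (comap_measurable fun ω s => Z s ω)).mul
        ((measurable_pi_apply t).comp (comap_measurable fun ω s => Z s ω))).stronglyMeasurable
      (X.indep_weightSigma h hK l)
  have h3 : P[Z s * Z t] = X.covGiven l s t := by
    have h4 := X.covariance_residual h hK l s t
    rw [covariance_eq_sub (hZ2 s) (hZ2 t), X.integral_residual h hK, zero_mul, sub_zero] at h4
    exact h4
  rw [h3] at h2
  exact h1.trans h2

/-- The rows of `B̃` one level up are the posterior basis functions, and those of regions not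
containing `s` vanish. This turns the claimed sum into a response of the posterior model. -/
theorem combine_eq_weightSum {S : Finset D}
    (hK : ∀ m < M, ∀ j : Fin m → Fin J, IsUnit (X.Kinv m j))
    (hS : ∀ j : Fin M → Fin J, IsUnit (Matrix.of fun s t : X.locs S M j => X.v M s t))
    (SP : Finset D)
    (z : ((a : (m : Fin M) × (Fin m → Fin J)) → EuclideanSpace ℝ (X.knots a.1 a.2)) ×
      ((j : Fin M → Fin J) → EuclideanSpace ℝ (X.locs SP M j)))
    (j : Fin M → Fin J) (s : X.locs SP M j) :
    X.combine S SP z j s =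
      weightSum (fun a z => z.1 a) (fun a => X.postBasis S a.1 a.2 s) z + (z.2 j).ofLp s := by
  rw [combine, weightSum, Fintype.sum_sigma]
  congr 1
  refine Finset.sum_congr rfl fun m _ => ?_
  rw [Finset.sum_eq_single (Fin.take m m.isLt.le j) _ (by simp)]
  · have hB : X.Btilde S SP (m + 1) m m.isLt (Nat.lt_succ_self m) j s =
        X.postBasis S m (Fin.take m m.isLt.le j) s :=
      funext fun p => X.Btilde_apply hK hS SP (m + 1) m m.isLt (Nat.lt_succ_self m) j s p
    rw [← hB]
    rfl
  · intro i _ hi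
    rw [X.postBasis_of_notMem hK hS m.isLt, zero_dotProduct]
    exact fun h => hi (X.region_unique m.isLt.le h
      (X.mem_region_take m.isLt.le le_rfl (X.mem_region_of_mem_locs SP s)))

/-- Both laws are Gaussian. The left one has mean `krig 0` and covariance `krigCov 0`, and the
telescoped identities show that the right one has the same. -/
theorem map_krig_add_error_eq {S : Finset D} (h : X.IsPrior P η δ) [IsProbabilityMeasure P]
    (hK : ∀ m < M, ∀ j : Fin m → Fin J, IsUnit (X.Kinv m j))
    (hS : ∀ j : Fin M → Fin J, IsUnit (Matrix.of fun s t : X.locs S M j => X.v M s t))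
    (SP : Finset D) (x : S → ℝ) :
    P.map (fun ω (j : Fin M → Fin J) (s : X.locs SP M j) => X.krig 0 s x +
        (X.y η δ s ω - X.krig 0 s fun t : S => X.y η δ t ω)) =
      (X.posteriorComponents S SP x).map (X.combine S SP) := by
  set E : D → Ω → ℝ := fun s ω => X.y η δ s ω - X.krig 0 s fun t : S => X.y η δ t ω with hE
  have hy := X.isGaussianProcess_y h hK
  have hym := X.measurable_y h hK
  have hy2 : ∀ s, MemLp (X.y η δ s) 2 P := fun s => (hy.hasGaussianLaw_eval s).memLp_two
  let w : D → S → ℝ := fun s => (fun t : S => X.covGiven 0 s t) ᵥ* (X.gram S 0)⁻¹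
  have hkrig : ∀ s g, X.krig 0 s g = ∑ t : S, w s t * g t := fun s g => by
    rw [krig, dotProduct_mulVec]
    rfl
  have hE' : ∀ s, E s = fun ω => X.y η δ s ω - ∑ t : S, w s t * X.y η δ t ω := fun s => by
    simp only [hE, hkrig]
  have hEm : ∀ s, Measurable (E s) := fun s => by
    rw [hE']
    fun_prop
  have hEp : IsGaussianProcess E P := by
    refine hy.of_isGaussianProcess fun s => ?_
    refine ⟨insert s S, ContinuousLinearMap.proj ⟨s, by simp⟩ -
      ∑ t : S, w s t • ContinuousLinearMap.proj ⟨(t : D), by simp⟩, fun ω => ?_⟩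
    simp [hE']
  have hEi : ∀ s, Integrable (E s) P := fun s => (hEp.hasGaussianLaw_eval s).integrable
  have hwy : ∀ s, MemLp (fun ω => ∑ t : S, w s t * X.y η δ t ω) 2 P := fun s =>
    memLp_finsetSum _ fun (t : S) _ => (hy2 t).const_mul _
  have hE0 : ∀ s, ∫ ω, E s ω ∂P = 0 := fun s => by
    rw [hE', integral_sub ((hy2 s).integrable (by simp)) ((hwy s).integrable (by simp)),
      integral_finsetSum _ fun (t : S) _ => ((hy2 t).const_mul _).integrable (by simp)]
    simp_rw [integral_const_mul, X.integral_y h hK]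
    simp
  have hGdet : IsUnit (X.gram S 0).det :=
    (Matrix.isUnit_iff_isUnit_det _).1 (X.posDef_gram hK hS 0).isUnit
  have hcomm := (X.isPosSemidefKernel_covGiven hK 0).comm
  -- The normal equations again: prediction errors are uncorrelated with the data.
  have hEy : ∀ s (t : S), cov[E s, X.y η δ t; P] = 0 := fun s t => by
    rw [hE', covariance_fun_sub_left (hy2 s) (hwy s) (hy2 t),
      covariance_fun_sum_left (fun u : S => (hy2 u).const_mul _) (hy2 t)]
    simp_rw [covariance_const_mul_left, X.covariance_y h hK]
    have h1 : ∑ u : S, w s u * X.covGiven 0 u t = (w s ᵥ* X.gram S 0) t := rfl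
    rw [h1, vecMul_vecMul, nonsing_inv_mul _ hGdet, vecMul_one, sub_self]
  -- Since `E s` is uncorrelated with the data, `E t` may be replaced by the process itself at `t`.
  have hEE : ∀ s t, cov[E s, E t; P] = X.krigCov S 0 s t := fun s t => by
    have hE2 : MemLp (E s) 2 P := (hEp.hasGaussianLaw_eval s).memLp_two
    rw [hE' t, covariance_fun_sub_right hE2 (hy2 t) (hwy t),
      covariance_fun_sum_right (fun u : S => (hy2 u).const_mul _) hE2]
    simp_rw [covariance_const_mul_right, hEy]
    rw [hE', covariance_fun_sub_left (hy2 s) (hwy s) (hy2 t),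
      covariance_fun_sum_left (fun u : S => (hy2 u).const_mul _) (hy2 t)]
    simp_rw [covariance_const_mul_left, X.covariance_y h hK]
    rw [krigCov, hkrig]
    simp [hcomm t]
  have hKt : ∀ a : (m : Fin M) × (Fin m → Fin J), (X.Ktilde S a.1 a.2).PosSemidef := fun a =>
    (X.posDef_KtildeInv hK hS a.1.2 a.2).inv.posSemidef
  have hmodel : IsGaussianModel (X.posteriorComponents S SP x) (fun a z => z.1 a)
      (fun a => X.Ktilde S a.1 a.2 *ᵥ X.omega S x a.1 a.2) (fun a => X.Ktilde S a.1 a.2)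
      fun (u : Σ j, X.locs SP M j) z => (z.2 u.1).ofLp u.2 :=
    isGaussianModel_prodGaussian hKt
  have hprob : IsProbabilityMeasure (X.posteriorComponents S SP x) := by
    unfold posteriorComponents
    infer_instance
  let R : (Σ j, X.locs SP M j) →
      ((a : (m : Fin M) × (Fin m → Fin J)) → EuclideanSpace ℝ (X.knots a.1 a.2)) ×
      ((j : Fin M → Fin J) → EuclideanSpace ℝ (X.locs SP M j)) → ℝ := fun u z =>
    weightSum (fun a z => z.1 a) (fun a => X.postBasis S a.1 a.2 u.2) z + (z.2 u.1).ofLp u.2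
  have hR : X.combine S SP = fun z j s => R ⟨j, s⟩ z :=
    funext fun z => funext fun j => funext fun s => X.combine_eq_weightSum hK hS SP z j s
  have hRm : ∀ u, Measurable (R u) := fun u =>
    (hmodel.measurable_weightSum _).add (hmodel.measurable_process u)
  have hRp : IsGaussianProcess R (X.posteriorComponents S SP x) :=
    hmodel.isGaussianProcess_response fun u a => X.postBasis S a.1 a.2 u.2
  have g1 : IsGaussian (P.map fun ω (j : Fin M → Fin J) (s : X.locs SP M j) =>
      X.krig 0 s x + E s ω) := by
    have h1 := (hEp.hasGaussianLaw_pi_pi fun (j : Fin M → Fin J) (s : X.locs SP M j) =>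
      (s : D)).isGaussian_map
    have h2 : (P.map fun ω (j : Fin M → Fin J) (s : X.locs SP M j) => X.krig 0 s x + E s ω) =
        (P.map fun ω (j : Fin M → Fin J) (s : X.locs SP M j) => E s ω).map
          fun z => (fun (j : Fin M → Fin J) (s : X.locs SP M j) => X.krig 0 (s : D) x) + z := by
      rw [Measure.map_map (by fun_prop) (by fun_prop)]
      rfl
    rw [h2]
    infer_instance
  have g2 : IsGaussian ((X.posteriorComponents S SP x).map (X.combine S SP)) := by
    rw [hR]
    exact (hRp.hasGaussianLaw_pi_pi fun j s => ⟨j, s⟩).isGaussian_map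
  have hm1 : Measurable fun ω (j : Fin M → Fin J) (s : X.locs SP M j) => X.krig 0 s x + E s ω := by
    fun_prop
  have hm2 : Measurable (X.combine S SP) := by
    rw [hR]
    fun_prop
  refine IsGaussian.ext_of_dual_span _ StrongDual.exists_eq_sum_proj ?_ ?_
  · rintro ⟨j, s⟩
    rw [integral_map hm1.aemeasurable (by fun_prop), integral_map hm2.aemeasurable (by fun_prop)]
    change ∫ ω, (X.krig 0 s x + E s ω) ∂P = ∫ z, X.combine S SP z j s ∂_
    rw [integral_add (integrable_const _) (hEi _), hE0, hR]
    refine Eq.trans ?_ (hmodel.integral_response (fun a => X.postBasis S a.1 a.2 s) ⟨j, s⟩).symm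
    have h1 : ∫ z, (z.2 j).ofLp s ∂(X.posteriorComponents S SP x) = X.deltaMean S SP x j s :=
      integral_snd_prodGaussian (κ' := fun j => X.locs SP M j) (m' := X.deltaMean S SP x) j s
    rw [h1, X.deltaMean_eq_krig hK hS, Fintype.sum_sigma]
    simpa using X.krig_zero_eq_sum hK hS s x
  · rintro ⟨j, s⟩ ⟨j', t⟩
    rw [covariance_map (by fun_prop) (by fun_prop) hm1.aemeasurable,
      covariance_map (by fun_prop) (by fun_prop) hm2.aemeasurable]
    change cov[fun ω => X.krig 0 s x + E s ω, fun ω => X.krig 0 t x + E t ω; P] =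
      cov[fun z => X.combine S SP z j s, fun z => X.combine S SP z j' t; _]
    rw [covariance_const_add_left (hEi _), covariance_const_add_right (hEi _), hEE, hR]
    refine Eq.trans ?_ (hmodel.covariance_response (fun a => X.postBasis S a.1 a.2 s)
      (fun a => X.postBasis S a.1 a.2 t) ⟨j, s⟩ ⟨j', t⟩).symm
    rw [X.krigCov_zero_eq_sum hK hS, Fintype.sum_sigma]
    congr 1
    -- What remains is the level-`M` error covariance: it is that of `δ̃` within one finest region,
    -- and zero between two, where the `δ̃` are independent.
    by_cases hj : j = j'
    · subst hj
      rw [← X.deltaCov_eq_krigCov hK hS]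
      exact (covariance_snd_prodGaussian (κ' := fun j => X.locs SP M j)
        (fun j => X.posSemidef_deltaCov hK hS SP j) j s t).symm
    · rw [X.krigCov_of_not_sameRegion hK hS le_rfl le_rfl]
      · exact (covariance_snd_prodGaussian_of_ne (κ' := fun j => X.locs SP M j) hj s t).symm
      · exact fun hst => hj (X.region_unique le_rfl (hst.mem le_rfl
          (X.mem_region_of_mem_locs SP s)) (X.mem_region_of_mem_locs SP t))

theorem condDistrib_y {S : Finset D} (h : X.IsPrior P η δ) [IsProbabilityMeasure P]
    (hK : ∀ m < M, ∀ j : Fin m → Fin J, IsUnit (X.Kinv m j))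
    (hS : ∀ j : Fin M → Fin J, IsUnit (Matrix.of fun s t : X.locs S M j => X.v M s t))
    (SP : Finset D) :
    ∀ᵐ y ∂(P.map fun ω (s : S) => X.y η δ s ω),
      condDistrib (fun ω (j : Fin M → Fin J) (s : X.locs SP M j) => X.y η δ s ω)
          (fun ω (s : S) => X.y η δ s ω) P y
        = (X.posteriorComponents S SP y).map (X.combine S SP) := by
  have hG := X.posDef_gram hK hS 0
  have h1 := (X.isGaussianProcess_y h hK).condDistrib_eq (X.measurable_y h hK) (S := S)
    ((Matrix.isUnit_iff_isUnit_det _).1 hG.isUnit)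
    (by simpa [conjTranspose_eq_transpose_of_trivial] using hG.isHermitian.eq)
    (fun s t => X.covariance_y h hK s t) fun (j : Fin M → Fin J) (s : X.locs SP M j) => (s : D)
  filter_upwards [h1] with x hx
  rw [hx, ← X.map_krig_add_error_eq h hK hS SP x]
  simp_rw [X.covariance_y h hK]
  rfl

end MRA

theorem proposition2 {D : Type*} [DecidableEq D] {J M : ℕ} (X : MRA D J M)
    (S SP : Finset D)
    (hK : ∀ m < M, ∀ j : Fin m → Fin J, IsUnit (X.Kinv m j))
    (hS : ∀ j : Fin M → Fin J,
      IsUnit (Matrix.of fun s t : X.locs S M j => X.v M s t))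
    {Ω : Type*} [MeasurableSpace Ω] (P : Measure Ω) [IsProbabilityMeasure P]
    (η : (m : Fin M) → (j : Fin m → Fin J) → Ω → EuclideanSpace ℝ (X.knots m j))
    (δ : D → Ω → ℝ) (hprior : X.IsPrior P η δ) :
    -- the function behind `Σ`, `V` and `L` is the conditional covariance given the weights
    -- at the levels below `l`
    (∀ l ≤ M, ∀ s t : D,
      P[(X.y η δ s - P[X.y η δ s | X.weightSigma η l]) *
          (X.y η δ t - P[X.y η δ t | X.weightSigma η l]) | X.weightSigma η l]
        =ᵐ[P] fun _ => X.covGiven l s t) ∧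
    -- all inverses exist, and all covariance matrices are covariance matrices
    (∀ m ≤ M, ∀ j : Fin m → Fin J, (X.Sig S m j).PosDef) ∧
    (∀ m < M, ∀ j : Fin m → Fin J,
      (X.K m j).PosDef ∧ (X.V S m j).PosDef ∧ (X.KtildeInv S m j).PosDef) ∧
    (∀ j : Fin M → Fin J, (X.deltaCov S SP j).PosSemidef) ∧
    -- the posterior predictive distribution, jointly for all finest regions
    (∀ᵐ y ∂(P.map fun ω (s : S) => X.y η δ s ω),
      condDistrib (fun ω (j : Fin M → Fin J) (s : X.locs SP M j) => X.y η δ s ω)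
          (fun ω (s : S) => X.y η δ s ω) P y
        = (X.posteriorComponents S SP y).map (X.combine S SP)) ∧
    -- the recursion for the posterior basis-function matrices
    (∀ (l k : ℕ) (hl : l < M) (hk : k < l) (j : Fin M → Fin J),
      X.Btilde S SP l k hl.le hk j =
        X.Btilde S SP (l + 1) k hl (hk.trans (Nat.lt_succ_self l)) j -
          X.Btilde S SP (l + 1) l hl (Nat.lt_succ_self l) j *
            X.Ktilde S l (Fin.take l hl.le j) *
            X.A S (Fin.take l hl.le j) (Fin.take k (hk.le.trans hl.le) j)
              (Fin.take l hl.le j)) := by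
  exact ⟨fun l _ s t => X.condExp_mul_eq_covGiven hprior hK l s t,
    fun m _ j => X.posDef_Sig hK hS m j,
    fun m hm j => ⟨X.posDef_K hK hm j, X.posDef_V hK hS m j, X.posDef_KtildeInv hK hS hm j⟩,
    X.posSemidef_deltaCov hK hS SP, X.condDistrib_y hprior hK hS SP,
    X.Btilde_succ hK hS SP⟩
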